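/- Let $G$ be a group and $S\subseteq G$ a finite generating set; $|g|_S$ denotes the word length of $g$, the least length of a word in $S\cup S^{-1}$ representing $g$. Say that $(G,S)$ has *exact exponential growth* if there are $\lambda>1$ and $c>0$ such that $$\lim_{n\to\infty}\frac{\#\{g\in G: |g|_S=n\}}{\lambda^n}=c .$$ A *graph structure* on a group $G$ is a finite directed graph $\Gamma$ with an initial vertex $v_0$, from which every vertex can be reached by a directed path, and with edges labeled by elements of $G$ such that distinct edges going out of the same vertex have distinct labels; a path evaluates to the product of its labels. It is a *geodesic combing* of $G$ with respect to $S$ if $S$ is the set of labels of all edges, evaluation is a bijection from the set of finite directed paths starting at $v_0$ onto $G$, and every finite directed path $p$ of $\Gamma$ evaluates to an element $g$ such that $|g|_S$ equals the length of $p$. Let $\Lambda$ be a finite simplicial graph with vertex set $V$. (a) For each $x\in V$ let $G_x$ be a nontrivial group that has a geodesic combing with respect to a subset $S_x$. Let $G(\Lambda)$ be the graph product, i.e. the quotient of the free product of the groups $G_x$ by the relations $[g,h]=1$ for $g\in G_x$, $h\in G_y$ and $x,y$ adjacent in $\Lambda$, with the standard generating set $S=\bigcup_{x} S_x$ (more precisely,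 the union of the images of the $S_x$). If $\Lambda$ is anticonnected, i.e. the complement graph of $\Lambda$ is connected, and $\Lambda$ has at least $3$ vertices, then $(G(\Lambda),S)$ has exact exponential growth. (b) Let $G$ be the right-angled Artin group $A(\Lambda)=\langle V : [x,y]=1 \text{ for } x,y \text{ adjacent}\rangle$ or the right-angled Coxeter group $C(\Lambda)=\langle V : x^2=1 \text{ for all } x,\ [x,y]=1 \text{ for } x,y \text{ adjacent}\rangle$, with the standard generating set $S=\{x^{\pm1}: x\in V\}$. If $G$ is not virtually cyclic and is not isomorphic to a direct product of two infinite groups, then $(G,S)$ has exact exponential growth. -/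

import Mathlib

open Filter Topology

universe u v

/-! ### Word length and exact exponential growth -/

section Growth

variable {G : Type*} [Group G]

/-- The word length `|g|_S`: the distance from `1` to `g` in the Cayley graph of `G` with respect
to `S`, i.e. the least length of a word in `S ∪ S⁻¹` representing `g`.
(It is only used when `S` generates `G`.) -/
noncomputable def wordLength (S : Set G) (g : G) : ℕ :=
  sInf {n : ℕ | ∃ w : List G, w.length = n ∧ (∀ s ∈ w, s ∈ S ∨ s⁻¹ ∈ S) ∧ w.prod = g}

/-- The sphere `{g ∈ G : |g|_S = n}`. -/
def wordSphere (S : Set G) (n : ℕ) : Set G :=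
  {g : G | wordLength S g = n}

/-- `G` has exact exponential growth with respect to the finite generating set `S`:
`#{g : |g|_S = n} / lam ^ n → c` for some `lam > 1` and `c > 0`. -/
def HasExactExponentialGrowth (S : Set G) : Prop :=
  S.Finite ∧ Subgroup.closure S = ⊤ ∧
    ∃ lam : ℝ, 1 < lam ∧ ∃ c : ℝ, 0 < c ∧
      Tendsto (fun n : ℕ => ((wordSphere S n).ncard : ℝ) / lam ^ n) atTop (𝓝 c)

end Growth

/-! ### Graph structures and geodesic combings -/

/-- A graph structure on the group `G`: a finite directed graph (multiple edges and loops are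
allowed) with an initial vertex from which every vertex can be reached, and whose edges are labeled
by elements of `G`, edges going out of the same vertex having distinct labels. A path is described
by its starting vertex and its list of edges. -/
structure GraphStructure (G : Type*) [Group G] where
  /-- the vertices -/
  Vert : Type
  /-- the directed edges -/
  Edge : Type
  finite_vert : Finite Vert
  finite_edge : Finite Edge
  /-- the tail of an edge -/
  src : Edge → Vert
  /-- the head of an edge -/
  tgt : Edge → Vert
  /-- the label of an edge -/
  label : Edge → G
  /-- the initial vertex -/
  init : Vert
  label_injective : ∀ e e' : Edge, src e = src e' → label e = label e' → e = e'
  /-- Every vertex `a` is the end point of a directed path starting at the initial vertex. -/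
  reachable : ∀ a : Vert, Relation.ReflTransGen (fun x y => ∃ e, src e = x ∧ tgt e = y) init a

namespace GraphStructure

variable {G : Type*} [Group G] (Γ : GraphStructure G)

/-- The list of edges `p` is a directed path starting at the vertex `a`. -/
def IsPathFrom (Γ : GraphStructure G) : Γ.Vert → List Γ.Edge → Prop
  | _, [] => True
  | a, e :: p => Γ.src e = a ∧ IsPathFrom Γ (Γ.tgt e) p

/-- The evaluation map on paths: the product of the labels. -/
def ev (p : List Γ.Edge) : G := (p.map Γ.label).prod

/-- The set `S = ev (E(Γ))` of all labels of edges. -/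
def labelSet : Set G := Set.range Γ.label

/-- A geodesic combing with respect to `S`: the labels form the set `S`, evaluation is a bijection
from the set of finite paths starting at the initial vertex onto `G`, and
`|ev p|_S` is the length of `p` for every finite path `p` (starting at any vertex). -/
structure IsGeodesicCombing (S : Set G) : Prop where
  labelSet_eq : Γ.labelSet = S
  bijOn : Set.BijOn Γ.ev {p | Γ.IsPathFrom Γ.init p} Set.univ
  geodesic : ∀ (a : Γ.Vert) (p : List Γ.Edge), Γ.IsPathFrom a p →
    wordLength S (Γ.ev p) = p.length

end GraphStructure

/-- `G` has a geodesic combing with respect to `S`. (Then `S` is automatically a finite generating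
set.) -/
def HasGeodesicCombing {G : Type*} [Group G] (S : Set G) : Prop :=
  ∃ Γ : GraphStructure G, Γ.IsGeodesicCombing S

/-! ### Graph products -/

section GraphProduct

variable {V : Type u} (Λ : SimpleGraph V) (G : V → Type v) [∀ x, Group (G x)]

/-- The relators of the graph product: the commutators `g h g⁻¹ h⁻¹` with `g ∈ G x`, `h ∈ G y` for
adjacent vertices `x`, `y`. -/
def graphProductRelators : Set (Monoid.CoprodI G) :=
  {r | ∃ (x y : V) (g : G x) (h : G y), Λ.Adj x y ∧
    r = Monoid.CoprodI.of g * Monoid.CoprodI.of h * (Monoid.CoprodI.of g)⁻¹ * (Monoid.CoprodI.of h)⁻¹}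

/-- The graph product `G(Λ)`: the quotient of the free product of the vertex groups by the
relations that the vertex groups of adjacent vertices commute. -/
abbrev GraphProduct : Type (max u v) :=
  Monoid.CoprodI G ⧸ Subgroup.normalClosure (graphProductRelators Λ G)

/-- The canonical homomorphism from a vertex group to the graph product. -/
def GraphProduct.of (x : V) : G x →* GraphProduct Λ G :=
  (QuotientGroup.mk' (Subgroup.normalClosure (graphProductRelators Λ G))).comp Monoid.CoprodI.of

variable {G}

/-- The standard generating set `⋃ x, S x` of the graph product, for given generating sets `S x` of
the vertex groups. -/
def GraphProduct.standardGenerators (S : ∀ x, Set (G x)) : Set (GraphProduct Λ G) :=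
  ⋃ x, GraphProduct.of Λ G x '' S x

end GraphProduct

/-! ### Right-angled Artin and Coxeter groups -/

section RightAngled

variable {V : Type u} (Λ : SimpleGraph V)

/-- The commutators `x y x⁻¹ y⁻¹` of adjacent vertices `x`, `y`, in the free group on the vertices. -/
def raagRelators : Set (FreeGroup V) :=
  {r | ∃ x y : V, Λ.Adj x y ∧
    r = FreeGroup.of x * FreeGroup.of y * (FreeGroup.of x)⁻¹ * (FreeGroup.of y)⁻¹}

/-- The relators of the right-angled Artin group together with the squares of the vertices. -/
def racgRelators : Set (FreeGroup V) :=
  raagRelators Λ ∪ {r | ∃ x : V, r = FreeGroup.of x ^ 2}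

/-- The right-angled Artin group `A(Λ)`. -/
abbrev RightAngledArtinGroup : Type u := PresentedGroup (raagRelators Λ)

/-- The right-angled Coxeter group `C(Λ)`. -/
abbrev RightAngledCoxeterGroup : Type u := PresentedGroup (racgRelators Λ)

/-- The set `{x, x⁻¹ : x ∈ V}` of vertex generators of a group presented with generators `V`. -/
def vertexGenerators (rels : Set (FreeGroup V)) : Set (PresentedGroup rels) :=
  {g | ∃ x : V, g = PresentedGroup.of x ∨ g = (PresentedGroup.of x)⁻¹}

end RightAngled

/-- `G` has a cyclic subgroup of finite index. -/
def IsVirtuallyCyclic (G : Type*) [Group G] : Prop :=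
  ∃ H : Subgroup G, H.FiniteIndex ∧ IsCyclic H

/-- `G` is isomorphic to a direct product of two infinite groups. -/
def IsProductOfInfiniteGroups (G : Type u) [Group G] : Prop :=
  ∃ (A B : Type u) (_ : Group A) (_ : Group B), Infinite A ∧ Infinite B ∧ Nonempty (G ≃* A × B)

/-! ### Word length -/

section WordLength

variable {G : Type*} [Group G] {S : Set G}

/-! Sphere sizes in a graph product obey a renewal equation. Let `W` be a set of vertices, `x` a
vertex outside it, and `L` the set of neighbours of `x` in `W`. Let `E` and `E_W` be the growth
series of the parabolic subgroups on `W ∪ {x}` and `W`. Let `a` count the nontrivial elements of `G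
x`, and `B` the nontrivial shortest representatives in `W` of right cosets of the parabolic subgroup
on `L`. Then `E = (1 + a) E_W + a B E` (`growthSeries_parabolic_insert`), so `F = a B` plays the
role of the step distribution of a renewal process.

Let `τ` be the radius of convergence of `E`. Splitting elements by length makes sphere sizes
submultiplicative, so a growth series that is finite at a point is finite a little beyond it
(`exists_lt_evalSeries_ne_top`); hence `E(τ) = ∞`. If the whole vertex set is anticonnected, the
renewal equation for smaller vertex sets shows by induction that every proper parabolic subgroup has
a finite series at `τ` (`growthValue_ne_top_of_ssubset`). So `F` converges beyond `τ` and `(1 + a)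
E_W` is finite at `τ`, and `E(τ) = ∞` forces `F(τ) = 1`. The renewal theorem `tendsto_renewal` now
gives a positive limit of the coefficients of `E` times `τ ^ n`, provided the steps are aperiodic,
here in the form that `F` has nonzero coefficients in degrees 2 and 3. Degree 2 comes from two
nonadjacent vertices. Degree 3 needs a third vertex on a path of the complement graph or an element
of length 2 in a vertex group; in the infinite dihedral group `F = z ^ 2` and this fails.

The group theory rests on an action of the graph product on heaps of syllables (`LayeredHeap`). It
makes the syllable `head x w` that can be split off on the left well defined; normal forms,
additivity of length and coset decompositions follow.

Artin and Coxeter groups are graph products of infinite cyclic groups and of groups of order 2. A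
disconnected complement graph gives a direct product decomposition. In the Artin case both factors
are infinite, so the graph is anticonnected. In the Coxeter case the vertices adjacent to all others
form a finite factor, the remaining ones are anticonnected, and if fewer than three remain the group
is virtually cyclic. -/

theorem wordLength_le {w : List G} (hw : ∀ s ∈ w, s ∈ S ∨ s⁻¹ ∈ S) :
    wordLength S w.prod ≤ w.length :=
  Nat.sInf_le ⟨w, rfl, hw, rfl⟩

theorem wordLength_one : wordLength S (1 : G) = 0 :=
  Nat.le_zero.1 (wordLength_le (S := S) (w := []) (by simp))

theorem wordLength_le_one {s : G} (hs : s ∈ S ∨ s⁻¹ ∈ S) : wordLength S s ≤ 1 := by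
  simpa using wordLength_le (S := S) (w := [s]) (by simpa using hs)

theorem exists_geodesic_word (hS : Subgroup.closure S = ⊤) (g : G) :
    ∃ w : List G, w.length = wordLength S g ∧ (∀ s ∈ w, s ∈ S ∨ s⁻¹ ∈ S) ∧ w.prod = g := by
  have hne : {n : ℕ | ∃ w : List G, w.length = n ∧ (∀ s ∈ w, s ∈ S ∨ s⁻¹ ∈ S) ∧
      w.prod = g}.Nonempty := by
    have hg : g ∈ Submonoid.closure (S ∪ S⁻¹) := by
      rw [← Subgroup.closure_toSubmonoid, hS]
      trivial
    obtain ⟨l, hl, hp⟩ := Submonoid.exists_list_of_mem_closure hg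
    exact ⟨l.length, l, rfl, fun s hs => by simpa using hl s hs, hp⟩
  exact Nat.sInf_mem hne

theorem wordLength_mul_le (hS : Subgroup.closure S = ⊤) (g h : G) :
    wordLength S (g * h) ≤ wordLength S g + wordLength S h := by
  obtain ⟨v, hv, hvS, rfl⟩ := exists_geodesic_word hS g
  obtain ⟨w, hw, hwS, rfl⟩ := exists_geodesic_word hS h
  rw [← hv, ← hw, ← List.prod_append, ← List.length_append]
  refine wordLength_le fun s hs => ?_
  rcases List.mem_append.1 hs with h | h
  exacts [hvS s h, hwS s h]

theorem wordLength_eq_zero (hS : Subgroup.closure S = ⊤) {g : G} :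
    wordLength S g = 0 ↔ g = 1 := by
  refine ⟨fun h => ?_, fun h => h ▸ wordLength_one⟩
  obtain ⟨w, hw, -, rfl⟩ := exists_geodesic_word hS g
  rw [h, List.length_eq_zero_iff] at hw
  simp [hw]

/-- A nontrivial element is a generator times a shorter element. -/
theorem exists_eq_mul_of_ne_one (hS : Subgroup.closure S = ⊤) {g : G} (hg : g ≠ 1) :
    ∃ s h : G, (s ∈ S ∨ s⁻¹ ∈ S) ∧ g = s * h ∧ wordLength S s = 1 ∧
      wordLength S g = wordLength S h + 1 := by
  obtain ⟨w, hw, hwS, hwp⟩ := exists_geodesic_word hS g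
  rcases w with _ | ⟨s, w⟩
  · exact absurd hwp.symm (by simpa using hg)
  · have h1 : wordLength S s ≤ 1 := wordLength_le_one (hwS s (by simp))
    have h2 : wordLength S w.prod ≤ w.length := wordLength_le fun a ha => hwS a (by simp [ha])
    have h3 := wordLength_mul_le hS s w.prod
    simp only [List.prod_cons, List.length_cons] at hwp hw
    rw [hwp] at h3
    exact ⟨s, w.prod, hwS s (by simp), hwp.symm, by omega, by omega⟩

theorem exists_wordLength_eq_one [Nontrivial G] (hS : Subgroup.closure S = ⊤) :
    ∃ g : G, wordLength S g = 1 := by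
  obtain ⟨g, hg⟩ := exists_ne (1 : G)
  obtain ⟨s, -, -, -, h, -⟩ := exists_eq_mul_of_ne_one hS hg
  exact ⟨s, h⟩

theorem finite_wordSphere (hf : S.Finite) (hS : Subgroup.closure S = ⊤) (n : ℕ) :
    {g : G | wordLength S g = n}.Finite := by
  have hT : (S ∪ S⁻¹).Finite := hf.union hf.inv
  have : Finite (S ∪ S⁻¹ : Set G) := hT
  refine Set.Finite.subset
    (Set.Finite.image (fun l : List (S ∪ S⁻¹ : Set G) => (l.map (↑)).prod)
      (List.finite_length_eq (S ∪ S⁻¹ : Set G) n)) fun g hg => ?_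
  obtain ⟨w, hw, hwS, rfl⟩ := exists_geodesic_word hS g
  refine ⟨w.attach.map fun s => ⟨s.1, by simpa using hwS s.1 s.2⟩, ?_, ?_⟩
  · simpa [hw] using hg
  · simp [List.map_map, Function.comp_def]

end WordLength

/-! ### The renewal theorem -/

section Renewal

open Finset

variable {p g v : ℕ → ℝ}

/-- In generating functions, `(1 - P) V = G`; dividing by `1 - z` turns `1 - P` into the series of
tails of `p` and `G` into its partial sums. This conserved quantity identifies the limit. -/
theorem sum_tail_mul_eq (hp0 : p 0 = 0)
    (hv : ∀ n, v n = g n + ∑ k ∈ range (n + 1), p k * v (n - k)) (n : ℕ) :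
    ∑ k ∈ range (n + 1), (1 - ∑ i ∈ range (k + 1), p i) * v (n - k) =
      ∑ j ∈ range (n + 1), g j := by
  induction n with
  | zero =>
    have h := hv 0
    simp only [zero_add, sum_range_one, hp0, zero_mul, add_zero, sub_zero, one_mul] at h ⊢
    exact h
  | succ n ih =>
    rw [sum_range_succ (fun j => g j) (n + 1), ← ih, sum_range_succ' _ (n + 1)]
    have h := hv (n + 1)
    rw [sum_range_succ' _ (n + 1)] at h
    simp only [Nat.add_sub_add_right, hp0, zero_mul, add_zero] at h
    simp only [Nat.add_sub_add_right, zero_add, sum_range_one, hp0, sub_zero, one_mul]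
    rw [Nat.sub_zero, h, add_comm (g (n + 1)), ← add_assoc, ← sum_add_distrib, add_left_inj]
    refine sum_congr rfl fun k _ => ?_
    rw [sum_range_succ _ (k + 1)]
    ring

/-- Markov's inequality: the mass of `p` beyond `k` is at most `R ^ (-k)` times the exponential
moment, so the tails are dominated by a geometric series. -/
theorem summable_tail (hp : ∀ n, 0 ≤ p n) (hsum : HasSum p 1) {R : ℝ} (hR : 1 < R)
    (hpR : Summable fun n => p n * R ^ n) :
    (∀ k, 0 ≤ 1 - ∑ i ∈ range (k + 1), p i) ∧
      Summable fun k => 1 - ∑ i ∈ range (k + 1), p i := by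
  have h0 : ∀ k, 0 ≤ 1 - ∑ i ∈ range (k + 1), p i := fun k =>
    sub_nonneg.2 (sum_le_hasSum _ (fun i _ => hp i) hsum)
  refine ⟨h0, Summable.of_nonneg_of_le h0 (f := fun k => (∑' n, p n * R ^ n) * (R⁻¹) ^ k) ?_ ?_⟩
  · intro k
    have hRk : (0 : ℝ) < R ^ k := by positivity
    rw [inv_pow, ← div_eq_mul_inv, le_div_iff₀ hRk]
    have h1 : 1 - ∑ i ∈ range (k + 1), p i = ∑' i, p (i + (k + 1)) := by
      rw [← hsum.tsum_eq, ← hsum.summable.sum_add_tsum_nat_add (k + 1)]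
      ring
    rw [h1, ← tsum_mul_right, ← hpR.sum_add_tsum_nat_add (k + 1)]
    have h2 : 0 ≤ ∑ i ∈ range (k + 1), p i * R ^ i :=
      sum_nonneg fun i _ => mul_nonneg (hp i) (by positivity)
    refine le_add_of_nonneg_of_le h2 (Summable.tsum_le_tsum (fun i => ?_) ?_ ?_)
    · exact mul_le_mul_of_nonneg_left (pow_le_pow_right₀ hR.le (by omega)) (hp _)
    · exact ((summable_nat_add_iff (f := p) (k + 1)).2 hsum.summable).mul_right (R ^ k)
    · exact (summable_nat_add_iff (f := fun n => p n * R ^ n) (k + 1)).2 hpR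
  · exact (summable_geometric_of_lt_one (by positivity) (inv_lt_one_of_one_lt₀ hR)).mul_left _

/-- Convolutions with a summable sequence pass to the limit along an ultrafilter. -/
theorem tendsto_conv {l : Filter ℕ} (hl : l ≤ atTop) {a : ℕ → ℝ} (ha : Summable fun n => |a n|)
    {M : ℝ} (hM : ∀ n, |v n| ≤ M) (j : ℕ) {V : ℕ → ℝ}
    (hV : ∀ k, Tendsto (fun n => v (n - (j + k))) l (𝓝 (V k))) :
    Tendsto (fun n => ∑ k ∈ range (n - j + 1), a k * v (n - j - k)) l (𝓝 (∑' k, a k * V k)) := by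
  -- Extending the finite sums by zero puts them on a fixed index set, with dominating series `|a k|
  -- * M`.
  have h : ∀ n, ∑ k ∈ range (n - j + 1), a k * v (n - j - k) =
      ∑' k, (if k ∈ range (n - j + 1) then a k * v (n - j - k) else 0) := fun n => by
    rw [tsum_eq_sum (s := range (n - j + 1)) (fun k hk => if_neg hk)]
    exact sum_congr rfl fun k hk => (if_pos hk).symm
  simp only [h]
  refine tendsto_tsum_of_dominated_convergence (bound := fun k => |a k| * M) (ha.mul_right M) ?_ ?_
  · intro k
    refine Tendsto.congr' ?_ ((hV k).const_mul (a k))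
    filter_upwards [hl (eventually_ge_atTop (j + k))] with n hn
    rw [if_pos (by simp only [mem_range]; omega), Nat.sub_sub]
  · refine Eventually.of_forall fun n k => ?_
    have hM0 : 0 ≤ M := (abs_nonneg _).trans (hM 0)
    split_ifs
    · rw [Real.norm_eq_abs, abs_mul]
      exact mul_le_mul_of_nonneg_left (hM _) (abs_nonneg _)
    · simpa using mul_nonneg (abs_nonneg _) hM0

/-- A maximum principle. Along an ultrafilter on which `v` tends to its largest cluster point `L`,
all shifts of `v` converge, and the limits `V j` satisfy the homogeneous equation `V j = ∑ p k * V
(j + k)`. An average of numbers at most `L` equals `L` only if every number of positive weight does,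
so `V` is constant from index 2 on, and `sum_tail_mul_eq` computes the constant. -/
theorem renewal_extremal (hp : ∀ n, 0 ≤ p n) (hp0 : p 0 = 0) (hsum : HasSum p 1) {R : ℝ}
    (hR : 1 < R) (hpR : Summable fun n => p n * R ^ n) (hp2 : 0 < p 2) (hp3 : 0 < p 3)
    (hg : Summable g) (hv : ∀ n, v n = g n + ∑ k ∈ range (n + 1), p k * v (n - k))
    {M : ℝ} (hM : ∀ n, |v n| ≤ M) {L : ℝ} (hL : MapClusterPt L atTop v)
    (hmax : ∀ L', MapClusterPt L' atTop v → L' ≤ L) :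
    L * ∑' k, (1 - ∑ i ∈ range (k + 1), p i) = ∑' n, g n := by
  obtain ⟨hq0, hq⟩ := summable_tail hp hsum hR hpR
  obtain ⟨U, hU, hUL⟩ := mapClusterPt_iff_ultrafilter.1 hL
  have hlim : ∀ j : ℕ, ∃ a, Tendsto (fun n => v (n - j)) (U : Filter ℕ) (𝓝 a) := fun j => by
    obtain ⟨a, -, ha⟩ := (isCompact_Icc (a := -M) (b := M)).ultrafilter_le_nhds
      (U.map fun n => v (n - j)) (le_principal_iff.2 (mem_map.2 (univ_mem' fun n =>
        abs_le.1 (hM (n - j)))))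
    exact ⟨a, ha⟩
  choose V hV using hlim
  have hV0 : V 0 = L := tendsto_nhds_unique (hV 0) hUL
  -- The shift by `j` pushes the ultrafilter to another one finer than `atTop`, so `V j` is itself a
  -- cluster point of `v`.
  have hVle : ∀ j, V j ≤ L := fun j => by
    refine hmax _ (mapClusterPt_iff_ultrafilter.2 ⟨U.map fun n => n - j, ?_, ?_⟩)
    · exact (map_mono hU).trans (tendsto_sub_atTop_nat j)
    · exact hV j
  have hshift : ∀ j : ℕ, Tendsto (fun n : ℕ => n - j) (U : Filter ℕ) atTop := fun j =>
    (tendsto_sub_atTop_nat j).mono_left hU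
  have hp' : Summable fun n => |p n| := by simpa only [abs_of_nonneg (hp _)] using hsum.summable
  have hrec : ∀ j, V j = ∑' k, p k * V (j + k) := fun j => by
    have h1 := tendsto_conv hU hp' hM j fun k => hV (j + k)
    have h2 := (hg.tendsto_atTop_zero.comp (hshift j)).add h1
    rw [zero_add] at h2
    exact tendsto_nhds_unique (hV j) (h2.congr fun n => (hv (n - j)).symm)
  have hVabs : ∀ j, |V j| ≤ M := fun j =>
    le_of_tendsto (hV j).abs (Eventually.of_forall fun n => hM _)
  have hpV : ∀ j, Summable fun k => p k * V (j + k) := fun j =>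
    Summable.of_norm_bounded (hp'.mul_right M) fun k => by
      rw [Real.norm_eq_abs, abs_mul]
      exact mul_le_mul_of_nonneg_left (hVabs _) (abs_nonneg _)
  have hstep : ∀ j, V j = L → ∀ k, 0 < p k → V (j + k) = L := fun j hj k hk => by
    have h1 : HasSum (fun k => p k * (L - V (j + k))) 0 := by
      have := (hsum.mul_right L).sub (hpV j).hasSum
      rw [← hrec j, hj, one_mul, sub_self] at this
      simpa only [mul_sub] using this
    have h2 := (hasSum_zero_iff_of_nonneg fun k =>
      mul_nonneg (hp k) (sub_nonneg.2 (hVle (j + k)))).1 h1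
    have h3 := congrFun h2 k
    simp only [Pi.zero_apply, mul_eq_zero] at h3
    rcases h3 with h3 | h3
    · exact absurd h3 hk.ne'
    · linarith
  -- The numbers 2 and 3 generate every integer from 2 on; this is where aperiodicity enters, and
  -- why the identity is evaluated at `n - 2` below.
  have hconst : ∀ j, V (2 + j) = L := fun j => by
    induction j using Nat.strong_induction_on with
    | _ j ih =>
      match j with
      | 0 => simpa using hstep 0 hV0 2 hp2
      | 1 => simpa using hstep 0 hV0 3 hp3
      | j + 2 => simpa [add_assoc] using hstep _ (ih j (by omega)) 2 hp2
  have hq' : Summable fun k => |1 - ∑ i ∈ range (k + 1), p i| := by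
    simpa only [abs_of_nonneg (hq0 _)] using hq
  have h1 := tendsto_conv hU hq' hM 2 fun k => hV (2 + k)
  simp only [sum_tail_mul_eq hp0 hv, hconst] at h1
  rw [tsum_mul_right, mul_comm] at h1
  have h2 := (hg.hasSum.tendsto_sum_nat.comp (tendsto_add_atTop_nat 1)).comp (hshift 2)
  exact tendsto_nhds_unique h1 h2

/-- A renewal theorem for delayed renewal sequences with exponentially small tails. -/
theorem tendsto_renewal (hp : ∀ n, 0 ≤ p n) (hp0 : p 0 = 0) (hsum : HasSum p 1) {R : ℝ}
    (hR : 1 < R) (hpR : Summable fun n => p n * R ^ n) (hp2 : 0 < p 2) (hp3 : 0 < p 3)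
    (hg : Summable g) (hg0 : ∀ n, 0 ≤ g n) (hgpos : 0 < g 0) (hv0 : ∀ n, 0 ≤ v n)
    (hv : ∀ n, v n = g n + ∑ k ∈ range (n + 1), p k * v (n - k)) :
    ∃ c, 0 < c ∧ Tendsto v atTop (𝓝 c) := by
  obtain ⟨hq0, hq⟩ := summable_tail hp hsum hR hpR
  set μ := ∑' k, (1 - ∑ i ∈ range (k + 1), p i) with hμdef
  have hμ : 0 < μ := by
    have h := hq.le_tsum 0 fun k _ => hq0 k
    simp only [zero_add, range_one, sum_singleton, hp0, sub_zero] at h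
    linarith
  have hgs : 0 < ∑' n, g n := hg.tsum_pos hg0 0 hgpos
  -- The tail of index 0 is 1 because `p 0 = 0`, so `v n` is a single term of the nonnegative sum in
  -- `sum_tail_mul_eq`.
  have hM : ∀ n, |v n| ≤ ∑' n, g n := fun n => by
    rw [abs_of_nonneg (hv0 n)]
    refine le_trans ?_ (hg.sum_le_tsum (range (n + 1)) fun i _ => hg0 i)
    rw [← sum_tail_mul_eq hp0 hv n]
    refine le_trans (le_of_eq ?_) (single_le_sum
      (f := fun k => (1 - ∑ i ∈ range (k + 1), p i) * v (n - k))
      (fun k _ => mul_nonneg (hq0 k) (hv0 _)) (mem_range.2 (Nat.succ_pos n)))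
    simp [hp0]
  have hmem : ∀ n, v n ∈ Set.Icc (-∑' n, g n) (∑' n, g n) := fun n => abs_le.1 (hM n)
  have hcpt : IsCompact {a | MapClusterPt a atTop v} := by
    refine (isCompact_Icc (a := -∑' n, g n) (b := ∑' n, g n)).of_isClosed_subset
      isClosed_setOfPred_clusterPt fun a ha => ?_
    exact isClosed_Icc.mem_of_mapClusterPt ha (Eventually.of_forall hmem)
  have hne : {a | MapClusterPt a atTop v}.Nonempty := by
    obtain ⟨a, -, ha⟩ := (isCompact_Icc (a := -∑' n, g n) (b := ∑' n, g n)).exists_mapClusterPt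
      (f := (atTop : Filter ℕ)) (u := v) (by
        exact le_principal_iff.2 (mem_map.2 (univ_mem' hmem)))
    exact ⟨a, ha⟩
  obtain ⟨b, hb, hbmax⟩ := hcpt.exists_isGreatest hne
  obtain ⟨a, ha, hamin⟩ := hcpt.exists_isLeast hne
  have hb' := renewal_extremal hp hp0 hsum hR hpR hp2 hp3 hg hv hM hb fun L' h => hbmax h
  -- The least cluster point of `v` is minus the greatest one of `-v`; both extremal values thus
  -- solve the same equation and coincide.
  have ha' := renewal_extremal (v := fun n => -v n) (g := fun n => -g n) (L := -a)
    hp hp0 hsum hR hpR hp2 hp3 hg.neg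
    (fun n => by simp only [hv n, neg_add, ← sum_neg_distrib, mul_neg]) (by simpa using hM)
    (ha.tendsto_comp (tendsto_neg a)) fun L' h => by
      have h2 : MapClusterPt (-L') atTop v := by
        simpa [Function.comp_def] using h.tendsto_comp (tendsto_neg L')
      linarith [hamin h2]
  rw [tsum_neg, neg_mul, neg_inj] at ha'
  have hab : a = b := mul_right_cancel₀ hμ.ne' (ha'.trans hb'.symm)
  refine ⟨b, ?_, ?_⟩
  · rw [← hb'] at hgs
    exact pos_of_mul_pos_left hgs hμ.le
  · refine isCompact_Icc.tendsto_nhds_of_unique_mapClusterPt (Eventually.of_forall hmem)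
      fun x _ hx => le_antisymm (hbmax hx) (hab ▸ hamin hx)

/-- A convolution of a summable sequence with a convergent one converges. -/
theorem tendsto_conv_atTop {a : ℕ → ℝ} (ha : Summable fun n => |a n|) {c : ℝ}
    (hv : Tendsto v atTop (𝓝 c)) :
    Tendsto (fun n => ∑ k ∈ range (n + 1), a k * v (n - k)) atTop (𝓝 ((∑' k, a k) * c)) := by
  obtain ⟨M, hM⟩ := (Metric.isBounded_range_of_tendsto v hv).exists_norm_le
  rw [← tsum_mul_right]
  exact tendsto_conv le_rfl ha (M := M) (fun n => hM _ ⟨n, rfl⟩) 0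
    (fun k => hv.comp (tendsto_sub_atTop_nat _))

end Renewal

/-! ### Layered configurations: a model of the graph product -/

/-- A heap of nontrivial syllables, in its layered (Cartier-Foata) form: `c x k` is the syllable of
the vertex group of `x` in the `k`-th layer, and it is `1` if there is none. The syllables in a
layer belong to pairwise adjacent vertices, and every syllable not in the lowest layer lies on
a syllable of the previous layer with which it does not commute. -/
@[ext]
structure LayeredHeap {V : Type u} (Λ : SimpleGraph V) (G : V → Type v) [∀ x, Group (G x)] where
  syl : ∀ x : V, ℕ → G x
  bounded : ∃ N, ∀ x k, N ≤ k → syl x k = 1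
  clique : ∀ x y k, x ≠ y → syl x k ≠ 1 → syl y k ≠ 1 → Λ.Adj x y
  support : ∀ x k, syl x (k + 1) ≠ 1 → ∃ y, y ≠ x ∧ ¬ Λ.Adj x y ∧ syl y k ≠ 1

namespace LayeredHeap

variable {V : Type u} {Λ : SimpleGraph V} {G : V → Type v} [∀ x, Group (G x)]

/-- No syllable of the heap obstructs a syllable at `x` falling down to layer `p`, except possibly
a syllable at `x` in layer `p` itself. -/
def IsFree (c : ∀ x : V, ℕ → G x) (Λ : SimpleGraph V) (x : V) (p : ℕ) : Prop :=
  (∀ y k, y ≠ x → ¬ Λ.Adj x y → p ≤ k → c y k = 1) ∧ ∀ k, p < k → c x k = 1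

/-- The layer where a syllable at `x` falling from above comes to rest. -/
noncomputable def pos (c : LayeredHeap Λ G) (x : V) : ℕ := sInf {p | IsFree c.syl Λ x p}

theorem isFree_pos (c : LayeredHeap Λ G) (x : V) : IsFree c.syl Λ x (c.pos x) := by
  obtain ⟨N, hN⟩ := c.bounded
  exact Nat.sInf_mem (s := {p | IsFree c.syl Λ x p})
    ⟨N, fun y k _ _ hk => hN y k hk, fun k hk => hN x k hk.le⟩

theorem pos_eq {c : LayeredHeap Λ G} {x : V} {p : ℕ} (h : IsFree c.syl Λ x p)
    (h' : ∀ q < p, ¬ IsFree c.syl Λ x q) : c.pos x = p :=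
  le_antisymm (Nat.sInf_le h) (not_lt.1 fun hlt => h' _ hlt (c.isFree_pos x))

/-- The topmost syllable at `x`, if no other syllable keeps it from being removed; otherwise `1`. -/
noncomputable def top (c : LayeredHeap Λ G) (x : V) : G x := c.syl x (c.pos x)

open Classical in
/-- The family of syllables obtained by multiplying the top syllable at `x` by `g`. -/
noncomputable def mulSyl (c : LayeredHeap Λ G) (x : V) (g : G x) : ∀ y : V, ℕ → G y :=
  Function.update c.syl x (Function.update (c.syl x) (c.pos x) (g * c.top x))

theorem mulSyl_pos (c : LayeredHeap Λ G) (x : V) (g : G x) :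
    c.mulSyl x g x (c.pos x) = g * c.top x := by
  simp [mulSyl]

theorem mulSyl_same (c : LayeredHeap Λ G) (x : V) (g : G x) {k : ℕ} (hk : k ≠ c.pos x) :
    c.mulSyl x g x k = c.syl x k := by
  simp [mulSyl, hk]

theorem mulSyl_other (c : LayeredHeap Λ G) (x : V) (g : G x) {y : V} (hy : y ≠ x) (k : ℕ) :
    c.mulSyl x g y k = c.syl y k := by
  simp [mulSyl, hy]

/-- Just below its resting layer, a syllable at `x` is obstructed. -/
theorem exists_support_pos (c : LayeredHeap Λ G) (x : V) {k : ℕ} (hk : c.pos x = k + 1) :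
    ∃ y, y ≠ x ∧ ¬ Λ.Adj x y ∧ c.syl y k ≠ 1 := by
  have h : ¬ IsFree c.syl Λ x k := fun h => by
    have := Nat.sInf_le (s := {p | IsFree c.syl Λ x p}) h
    change c.pos x ≤ k at this
    omega
  have hf := c.isFree_pos x
  rw [hk] at hf
  by_contra! hcon
  refine h ⟨fun y j hy hxy hj => ?_, fun j hj => ?_⟩
  · rcases hj.eq_or_lt with rfl | hj
    · exact hcon y hy hxy
    · exact hf.1 y j hy hxy hj
  · rcases (Nat.succ_le_of_lt hj).eq_or_lt with rfl | hj
    · by_contra hne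
      obtain ⟨y, hy, hxy, h1⟩ := c.support x k hne
      exact h1 (hcon y hy hxy)
    · exact hf.2 j hj

/-- Left multiplication by an element of a vertex group. -/
noncomputable def mul (c : LayeredHeap Λ G) (x : V) (g : G x) : LayeredHeap Λ G where
  syl := c.mulSyl x g
  bounded := by
    obtain ⟨N, hN⟩ := c.bounded
    refine ⟨max N (c.pos x + 1), fun y k hk => ?_⟩
    have h1 : N ≤ k := (le_max_left _ _).trans hk
    have h2 : c.pos x + 1 ≤ k := (le_max_right _ _).trans hk
    by_cases hy : y = x
    · subst hy
      rw [mulSyl_same _ _ _ (by omega), hN _ _ h1]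
    · rw [mulSyl_other _ _ _ hy, hN _ _ h1]
  clique := by
    have key : ∀ y k, y ≠ x → c.mulSyl x g x k ≠ 1 → c.syl y k ≠ 1 → Λ.Adj x y := by
      intro y k hy hx hyk
      by_cases hk : k = c.pos x
      · by_contra hadj
        exact hyk ((c.isFree_pos x).1 y k hy hadj hk.ge)
      · rw [mulSyl_same _ _ _ hk] at hx
        exact c.clique x y k hy.symm hx hyk
    intro y z k hyz hy hz
    by_cases hyx : y = x
    · subst hyx
      rw [mulSyl_other _ _ _ hyz.symm] at hz
      exact key z k hyz.symm hy hz
    · rw [mulSyl_other _ _ _ hyx] at hy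
      by_cases hzx : z = x
      · subst hzx
        exact (key y k hyx hz hy).symm
      · rw [mulSyl_other _ _ _ hzx] at hz
        exact c.clique y z k hyz hy hz
  support := by
    intro y k hy
    by_cases hyx : y = x
    · subst hyx
      obtain ⟨z, hz, hyz, hzk⟩ : ∃ z, z ≠ y ∧ ¬ Λ.Adj y z ∧ c.syl z k ≠ 1 := by
        by_cases hk : k + 1 = c.pos y
        · exact c.exists_support_pos y hk.symm
        · rw [mulSyl_same _ _ _ hk] at hy
          exact c.support y k hy
      exact ⟨z, hz, hyz, by rwa [mulSyl_other _ _ _ hz]⟩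
    · rw [mulSyl_other _ _ _ hyx] at hy
      obtain ⟨z, hz, hyz, hzk⟩ := c.support y k hy
      refine ⟨z, hz, hyz, ?_⟩
      by_cases hzx : z = x
      · subst hzx
        -- A syllable resting on the modified one would be a noncommuting syllable above the layer
        -- `c.pos z`, contrary to freeness; so even erasing the top syllable leaves nothing
        -- unsupported.
        have hk : k ≠ c.pos z := by
          rintro rfl
          exact hy ((c.isFree_pos z).1 y _ hyx (fun h => hyz h.symm) (Nat.le_succ _))
        rwa [mulSyl_same _ _ _ hk]
      · rwa [mulSyl_other _ _ _ hzx]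

theorem mul_syl (c : LayeredHeap Λ G) (x : V) (g : G x) : (c.mul x g).syl = c.mulSyl x g := rfl

/-- What stops a syllable at `x` from falling further is always a syllable at another vertex
(`exists_support_pos`), and these do not change. In particular, cancelling the top syllable does not
lower the resting layer. -/
theorem pos_mul_self (c : LayeredHeap Λ G) (x : V) (g : G x) : (c.mul x g).pos x = c.pos x := by
  have hf := c.isFree_pos x
  refine pos_eq ⟨fun y k hy hxy hk => ?_, fun k hk => ?_⟩ fun q hq hfree => ?_
  · rw [mul_syl, mulSyl_other _ _ _ hy, hf.1 y k hy hxy hk]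
  · rw [mul_syl, mulSyl_same _ _ _ hk.ne', hf.2 k hk]
  · obtain ⟨k, hk⟩ := Nat.exists_eq_add_of_lt (lt_of_le_of_lt (Nat.zero_le q) hq)
    rw [zero_add] at hk
    obtain ⟨y, hy, hxy, h1⟩ := c.exists_support_pos x hk
    refine h1 ?_
    rw [← hfree.1 y k hy hxy (by omega), mul_syl, mulSyl_other _ _ _ hy]

theorem pos_mul_adj (c : LayeredHeap Λ G) {x y : V} (hxy : Λ.Adj x y) (g : G y) :
    (c.mul y g).pos x = c.pos x := by
  have h : ∀ p, IsFree (c.mul y g).syl Λ x p ↔ IsFree c.syl Λ x p := fun p => by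
    refine and_congr (forall₂_congr fun z k => forall₂_congr fun _ hz => ?_)
      (forall_congr' fun k => ?_)
    · rw [mul_syl, mulSyl_other _ _ _ (by rintro rfl; exact hz hxy)]
    · rw [mul_syl, mulSyl_other _ _ _ hxy.ne]
  simp only [pos, h]

theorem top_mul_self (c : LayeredHeap Λ G) (x : V) (g : G x) :
    (c.mul x g).top x = g * c.top x := by
  rw [top, pos_mul_self, mul_syl, mulSyl_pos]

theorem top_mul_adj (c : LayeredHeap Λ G) {x y : V} (hxy : Λ.Adj x y) (g : G y) :
    (c.mul y g).top x = c.top x := by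
  rw [top, pos_mul_adj c hxy, mul_syl, mulSyl_other _ _ _ hxy.ne, top]

/-- The nontrivial syllable now at `y` blocks `x`, so `x` comes to rest strictly above the layer
`c.pos y`, where freeness of `y` leaves no syllable at `x`. -/
theorem top_mul_not_adj (c : LayeredHeap Λ G) {x y : V} (hne : x ≠ y) (hxy : ¬ Λ.Adj x y) (g : G y)
    (hg : g * c.top y ≠ 1) : (c.mul y g).top x = 1 := by
  have h1 : c.pos y < (c.mul y g).pos x := by
    by_contra! hle
    have := ((c.mul y g).isFree_pos x).1 y _ hne.symm hxy hle
    rw [mul_syl, mulSyl_pos] at this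
    exact hg this
  rw [top, mul_syl, mulSyl_other _ _ _ hne]
  exact (c.isFree_pos y).1 x _ hne (fun h => hxy h.symm) h1.le

theorem one_mul_heap (c : LayeredHeap Λ G) (x : V) : c.mul x 1 = c := by
  ext y k
  rw [mul_syl]
  by_cases hy : y = x
  · subst hy
    by_cases hk : k = c.pos y
    · rw [hk, mulSyl_pos, one_mul, top]
    · rw [mulSyl_same _ _ _ hk]
  · rw [mulSyl_other _ _ _ hy]

theorem mul_mul_heap (c : LayeredHeap Λ G) (x : V) (g h : G x) :
    c.mul x (g * h) = (c.mul x h).mul x g := by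
  ext y k
  rw [mul_syl, mul_syl]
  by_cases hy : y = x
  · subst hy
    by_cases hk : k = c.pos y
    · rw [hk, mulSyl_pos, ← pos_mul_self c y h, mulSyl_pos, top_mul_self, mul_assoc]
    · rw [mulSyl_same _ _ _ hk, mulSyl_same _ _ _ (by rwa [pos_mul_self]), mul_syl,
        mulSyl_same _ _ _ hk]
  · rw [mulSyl_other _ _ _ hy, mulSyl_other _ _ _ hy, mul_syl, mulSyl_other _ _ _ hy]

theorem mul_comm_of_adj (c : LayeredHeap Λ G) {x y : V} (hxy : Λ.Adj x y) (g : G x) (h : G y) :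
    (c.mul y h).mul x g = (c.mul x g).mul y h := by
  have key : ∀ {x y : V} (_ : Λ.Adj x y) (g : G x) (h : G y) (k : ℕ),
      (c.mul y h).mulSyl x g x k = (c.mul x g).mulSyl y h x k := by
    intro x y hxy g h k
    rw [mulSyl_other _ _ _ hxy.ne, mul_syl]
    by_cases hk : k = c.pos x
    · rw [hk, mulSyl_pos]
      nth_rewrite 1 [← pos_mul_adj c hxy h]
      rw [mulSyl_pos, top_mul_adj c hxy]
    · rw [mulSyl_same _ _ _ hk, mulSyl_same _ _ _ (by rwa [pos_mul_adj c hxy]), mul_syl,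
        mulSyl_other _ _ _ hxy.ne]
  ext z k
  rw [mul_syl, mul_syl]
  by_cases hx : z = x
  · subst hx
    exact key hxy g h k
  · by_cases hy : z = y
    · subst hy
      exact (key hxy.symm h g k).symm
    · rw [mulSyl_other _ _ _ hx, mulSyl_other _ _ _ hy, mul_syl, mul_syl, mulSyl_other _ _ _ hx,
        mulSyl_other _ _ _ hy]

/-- The empty heap. -/
noncomputable def empty : LayeredHeap Λ G where
  syl := fun _ _ => 1
  bounded := ⟨0, fun _ _ _ => rfl⟩
  clique := fun _ _ _ _ h => absurd rfl h
  support := fun _ _ h => absurd rfl h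

variable (Λ G) in
/-- A vertex group acts on heaps by permutations. -/
noncomputable def vertexPerm (x : V) : G x →* Equiv.Perm (LayeredHeap Λ G) where
  toFun g :=
    { toFun := fun c => c.mul x g
      invFun := fun c => c.mul x g⁻¹
      left_inv := fun c => by simp only [← mul_mul_heap, inv_mul_cancel, one_mul_heap]
      right_inv := fun c => by simp only [← mul_mul_heap, mul_inv_cancel, one_mul_heap] }
  map_one' := Equiv.ext fun c => one_mul_heap c x
  map_mul' g h := Equiv.ext fun c => mul_mul_heap c x g h

variable (Λ G) in
/-- The graph product acts on heaps. -/
noncomputable def perm : GraphProduct Λ G →* Equiv.Perm (LayeredHeap Λ G) :=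
  QuotientGroup.lift _ (Monoid.CoprodI.lift (vertexPerm Λ G)) (by
    refine Subgroup.normalClosure_le_normal ?_
    rintro r ⟨x, y, g, h, hxy, rfl⟩
    have hcomm : vertexPerm Λ G x g * vertexPerm Λ G y h =
        vertexPerm Λ G y h * vertexPerm Λ G x g :=
      Equiv.ext fun c => mul_comm_of_adj c hxy g h
    rw [SetLike.mem_coe, MonoidHom.mem_ker]
    simp only [map_mul, map_inv, Monoid.CoprodI.lift_of]
    rw [hcomm, mul_inv_cancel_right, mul_inv_cancel])

theorem perm_of_mul (x : V) (g : G x) (w : GraphProduct Λ G) (c : LayeredHeap Λ G) :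
    perm Λ G (GraphProduct.of Λ G x g * w) c = (perm Λ G w c).mul x g := by
  rw [map_mul, Equiv.Perm.mul_apply]
  have : perm Λ G (GraphProduct.of Λ G x g) = vertexPerm Λ G x g := by
    simp [perm, GraphProduct.of]
  rw [this]
  rfl

/-- The total length of the syllables of a heap, for given length functions on the vertex groups. -/
noncomputable def size (ℓ : ∀ x, G x → ℕ) (c : LayeredHeap Λ G) : ℕ :=
  ∑ᶠ q : V × ℕ, ℓ q.1 (c.syl q.1 q.2)

theorem finite_support_size [Finite V] {ℓ : ∀ x, G x → ℕ} (hℓ : ∀ x, ℓ x 1 = 0)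
    (c : LayeredHeap Λ G) : (Function.support fun q : V × ℕ => ℓ q.1 (c.syl q.1 q.2)).Finite := by
  obtain ⟨N, hN⟩ := c.bounded
  refine (Set.finite_univ.prod (Set.finite_Iio N)).subset fun q hq => ⟨trivial, ?_⟩
  by_contra hle
  exact hq (by simp [hN q.1 q.2 (not_lt.1 hle), hℓ])

/-- A trivial top means that the slot where the new syllable lands was vacant, so the sum gains
exactly one term. -/
theorem size_mul [Finite V] {ℓ : ∀ x, G x → ℕ} (hℓ : ∀ x, ℓ x 1 = 0) (c : LayeredHeap Λ G) (x : V)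
    (g : G x) (hx : c.top x = 1) : (c.mul x g).size ℓ = ℓ x g + c.size ℓ := by
  classical
  have h : ∀ q : V × ℕ, ℓ q.1 ((c.mul x g).syl q.1 q.2) =
      (if q = (x, c.pos x) then ℓ x g else 0) + ℓ q.1 (c.syl q.1 q.2) := by
    rintro ⟨y, k⟩
    rw [mul_syl]
    by_cases hy : y = x
    · subst hy
      by_cases hk : k = c.pos y
      · have h1 : c.syl y (c.pos y) = 1 := hx
        simp [hk, mulSyl_pos, hx, h1, hℓ]
      · simp [hk, mulSyl_same]
    · simp [hy, mulSyl_other]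
  rw [size, finsum_congr h, finsum_add_distrib _ (finite_support_size hℓ c), size,
    finsum_eq_single _ (x, c.pos x) fun q hq => if_neg hq, if_pos rfl]
  exact (Set.finite_singleton (x, c.pos x)).subset fun q hq => by
    by_contra hne
    exact hq (if_neg hne)

theorem size_empty {ℓ : ∀ x, G x → ℕ} (hℓ : ∀ x, ℓ x 1 = 0) :
    (empty : LayeredHeap Λ G).size ℓ = 0 := by
  simp [size, empty, hℓ]

end LayeredHeap

/-! ### Heads, normal forms and the word length in graph products -/

namespace GraphProduct

open LayeredHeap

variable {V : Type u} {Λ : SimpleGraph V} {G : V → Type v} [∀ x, Group (G x)]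

theorem of_mul_of_comm {x y : V} (h : Λ.Adj x y) (g : G x) (k : G y) :
    of Λ G x g * of Λ G y k = of Λ G y k * of Λ G x g := by
  rw [← mul_inv_eq_one, mul_inv_rev, ← mul_assoc]
  change (QuotientGroup.mk' _ _ : GraphProduct Λ G) = 1
  rw [QuotientGroup.mk'_apply, QuotientGroup.eq_one_iff]
  refine Subgroup.subset_normalClosure ⟨x, y, g, k, h, ?_⟩
  simp [mul_assoc]

theorem closure_range_of : ⨆ x, (of Λ G x).range = ⊤ := by
  have h : Monoid.CoprodI.lift (fun x => of Λ G x) =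
      QuotientGroup.mk' (Subgroup.normalClosure (graphProductRelators Λ G)) :=
    Monoid.CoprodI.ext_hom _ _ fun x => by
      ext g
      simp [of]
  rw [← Monoid.CoprodI.range_eq_iSup, h]
  exact MonoidHom.range_eq_top.2 (QuotientGroup.mk'_surjective _)

/-- The maximal element of the vertex group of `x` that can be split off `w` on the left. -/
noncomputable def head (x : V) (w : GraphProduct Λ G) : G x := (perm Λ G w empty).top x

/-- This and the next three rules determine `head`. Apart from the size computation in `exists_len`,
heaps are used below only through them. -/
theorem head_one (x : V) : head x (1 : GraphProduct Λ G) = 1 := by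
  rw [head, map_one]
  rfl

theorem head_of_mul_self (x : V) (g : G x) (w : GraphProduct Λ G) :
    head x (of Λ G x g * w) = g * head x w := by
  rw [head, perm_of_mul, top_mul_self, head]

theorem head_of_mul_adj {x y : V} (hxy : Λ.Adj x y) (g : G y) (w : GraphProduct Λ G) :
    head x (of Λ G y g * w) = head x w := by
  rw [head, perm_of_mul, top_mul_adj _ hxy, head]

theorem head_of_mul_not_adj {x y : V} (hne : x ≠ y) (hxy : ¬ Λ.Adj x y) {g : G y}
    {w : GraphProduct Λ G} (hg : g * head y w ≠ 1) : head x (of Λ G y g * w) = 1 := by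
  rw [head, perm_of_mul, top_mul_not_adj _ hne hxy _ hg]

/-- The subgroup generated by the vertex groups of the vertices in `U`. -/
def parabolic (Λ : SimpleGraph V) (G : V → Type v) [∀ x, Group (G x)] (U : Set V) :
    Subgroup (GraphProduct Λ G) :=
  Subgroup.closure {w | ∃ x ∈ U, ∃ g : G x, of Λ G x g = w}

theorem of_mem_parabolic {U : Set V} {x : V} (hx : x ∈ U) (g : G x) :
    of Λ G x g ∈ parabolic Λ G U :=
  Subgroup.subset_closure ⟨x, hx, g, rfl⟩

theorem parabolic_mono {U W : Set V} (h : U ⊆ W) : parabolic Λ G U ≤ parabolic Λ G W :=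
  Subgroup.closure_mono fun _ ⟨x, hx, g, hg⟩ => ⟨x, h hx, g, hg⟩

theorem parabolic_univ : parabolic Λ G Set.univ = ⊤ := by
  rw [eq_top_iff, ← closure_range_of, iSup_le_iff]
  rintro x _ ⟨g, rfl⟩
  exact of_mem_parabolic (Set.mem_univ x) g

/-- Elements that are products of reduced words of syllables at vertices in `U`. -/
inductive IsReduced (U : Set V) : GraphProduct Λ G → Prop
  | one : IsReduced U 1
  | of_mul (x : V) (hx : x ∈ U) (g : G x) (hg : g ≠ 1) (w : GraphProduct Λ G) (hw : IsReduced U w)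
      (hhead : head x w = 1) : IsReduced U (of Λ G x g * w)

/-- The head at `x` commutes past the adjacent syllables in front of it until it meets the syllable
at `x` that it deletes; if a nonadjacent syllable comes first, the head is trivial. -/
theorem IsReduced.strip {U : Set V} {w : GraphProduct Λ G} (hw : IsReduced U w) (x : V) :
    IsReduced U (of Λ G x (head x w)⁻¹ * w) := by
  induction hw with
  | one => simpa [head_one] using IsReduced.one
  | of_mul y hy g hg w hw hhead ih =>
    by_cases hxy : x = y
    · subst hxy
      rw [head_of_mul_self, hhead, mul_one, ← mul_assoc, ← map_mul, inv_mul_cancel, map_one,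
        one_mul]
      exact hw
    · by_cases hadj : Λ.Adj x y
      · rw [head_of_mul_adj hadj, ← mul_assoc, of_mul_of_comm hadj, mul_assoc]
        exact .of_mul y hy g hg _ ih (by rw [head_of_mul_adj hadj.symm, hhead])
      · rw [head_of_mul_not_adj hxy hadj (by rwa [hhead, mul_one]), inv_one, map_one, one_mul]
        exact .of_mul y hy g hg w hw hhead

theorem head_strip (x : V) (w : GraphProduct Λ G) : head x (of Λ G x (head x w)⁻¹ * w) = 1 := by
  rw [head_of_mul_self, inv_mul_cancel]

theorem of_head_mul_strip (x : V) (w : GraphProduct Λ G) :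
    of Λ G x (head x w) * (of Λ G x (head x w)⁻¹ * w) = w := by
  rw [← mul_assoc, ← map_mul, mul_inv_cancel, map_one, one_mul]

theorem IsReduced.mul {U : Set V} {w : GraphProduct Λ G} (hw : IsReduced U w) {x : V} (hx : x ∈ U)
    (g : G x) : IsReduced U (of Λ G x g * w) := by
  rw [← of_head_mul_strip x w, ← mul_assoc, ← map_mul]
  by_cases h : g * head x w = 1
  · rw [h, map_one, one_mul]
    exact hw.strip x
  · exact .of_mul x hx _ h _ (hw.strip x) (head_strip x w)

/-- Reduced elements are closed under left multiplication by syllables, since a new syllable either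
merges with the head at its vertex, cancels it, or is put in front. -/
theorem mem_parabolic_iff {U : Set V} {w : GraphProduct Λ G} :
    w ∈ parabolic Λ G U ↔ IsReduced U w := by
  refine ⟨fun h => ?_, fun h => ?_⟩
  · induction h using Subgroup.closure_induction_left with
    | one => exact .one
    | mul_left w hw v _ ih =>
      obtain ⟨x, hx, g, rfl⟩ := hw
      exact ih.mul hx g
    | inv_mul_cancel w hw v _ ih =>
      obtain ⟨x, hx, g, rfl⟩ := hw
      rw [← map_inv]
      exact ih.mul hx g⁻¹
  · induction h with
    | one => exact one_mem _
    | of_mul x hx g hg w hw hhead ih => exact mul_mem (of_mem_parabolic hx g) ih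

/-- Induction on reduced words. -/
theorem parabolic_induction {U : Set V} {P : GraphProduct Λ G → Prop} (one : P 1)
    (of_mul : ∀ x ∈ U, ∀ (g : G x), g ≠ 1 → ∀ w ∈ parabolic Λ G U, head x w = 1 → P w →
      P (of Λ G x g * w)) {w : GraphProduct Λ G} (hw : w ∈ parabolic Λ G U) : P w := by
  have h := mem_parabolic_iff.1 hw
  clear hw
  induction h with
  | one => exact one
  | of_mul x hx g hg w hw hhead ih => exact of_mul x hx g hg w (mem_parabolic_iff.2 hw) hhead ih

theorem exists_head_ne_one {U : Set V} {w : GraphProduct Λ G} (hw : w ∈ parabolic Λ G U)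
    (h : w ≠ 1) : ∃ x ∈ U, head x w ≠ 1 := by
  rcases mem_parabolic_iff.1 hw with _ | ⟨x, hx, g, hg, w, -, hhead⟩
  · exact absurd rfl h
  · exact ⟨x, hx, by rwa [head_of_mul_self, hhead, mul_one]⟩

theorem head_eq_one_of_notMem {U : Set V} {w : GraphProduct Λ G} (hw : w ∈ parabolic Λ G U)
    {x : V} (hx : x ∉ U) : head x w = 1 := by
  refine parabolic_induction (P := fun w => head x w = 1) (head_one x)
    (fun y hy g hg w hw hhead ih => ?_) hw
  have hxy : x ≠ y := by
    rintro rfl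
    exact hx hy
  by_cases hadj : Λ.Adj x y
  · rw [head_of_mul_adj hadj, ih]
  · exact head_of_mul_not_adj hxy hadj (by rwa [hhead, mul_one])

theorem of_injective (x : V) : Function.Injective (of Λ G x) := fun g h hgh => by
  have h1 := head_of_mul_self (Λ := Λ) x g 1
  rw [hgh, head_of_mul_self, head_one, mul_one, mul_one] at h1
  exact h1.symm

/-! #### The word length -/

variable {S : ∀ x, Set (G x)}

theorem standardGenerators_finite [Finite V] (hS : ∀ x, (S x).Finite) :
    (standardGenerators Λ S).Finite :=
  Set.finite_iUnion fun x => (hS x).image _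

theorem closure_standardGenerators (hS : ∀ x, Subgroup.closure (S x) = ⊤) :
    Subgroup.closure (standardGenerators Λ S) = ⊤ := by
  simp only [standardGenerators, Subgroup.closure_iUnion, ← MonoidHom.map_closure, hS,
    ← MonoidHom.range_eq_map, closure_range_of]

variable (S) in
/-- The word length with respect to the standard generators. -/
noncomputable def len (w : GraphProduct Λ G) : ℕ := wordLength (standardGenerators Λ S) w

/-- Word length is the heap size `ℓ`, the total length of the syllables. A generator raises `ℓ` by
at most 1, since it only changes one head, which gives `ℓ ≤ len`; spelling out the syllables of a
reduced word gives the converse. Additivity of `ℓ` on reduced products then carries over to `len`.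
-/
theorem exists_len [Finite V] (hS : ∀ x, Subgroup.closure (S x) = ⊤) :
    (∀ (x : V) (g : G x), len (Λ := Λ) S (of Λ G x g) = wordLength (S x) g) ∧
    ∀ (x : V) (g : G x) (w : GraphProduct Λ G), head x w = 1 →
      len S (of Λ G x g * w) = wordLength (S x) g + len S w := by
  have hgen := closure_standardGenerators (Λ := Λ) hS
  have hl1 : ∀ x, wordLength (S x) (1 : G x) = 0 := fun x => wordLength_one
  set ℓ : GraphProduct Λ G → ℕ := fun w =>
    (perm Λ G w empty).size fun x => wordLength (S x) with hℓ
  have ℓ1 : ℓ 1 = 0 := by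
    simp only [hℓ, map_one, Equiv.Perm.one_apply]
    exact size_empty hl1
  have ℓmul : ∀ (x : V) (g : G x) (w : GraphProduct Λ G), head x w = 1 →
      ℓ (of Λ G x g * w) = wordLength (S x) g + ℓ w := fun x g w hw => by
    simp only [hℓ, perm_of_mul]
    exact size_mul hl1 _ x g hw
  have hstep : ∀ (x : V) (s : G x) (w : GraphProduct Λ G), wordLength (S x) s ≤ 1 →
      ℓ (of Λ G x s * w) ≤ ℓ w + 1 := fun x s w hs => by
    rw [← of_head_mul_strip x w, ← mul_assoc, ← map_mul, ℓmul _ _ _ (head_strip x w),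
      ℓmul _ _ _ (head_strip x w)]
    have := wordLength_mul_le (hS x) s (head x w)
    omega
  have hle : ∀ w, ℓ w ≤ len S w := fun w => by
    obtain ⟨l, hl, hlS, rfl⟩ := exists_geodesic_word hgen w
    rw [len, ← hl]
    clear hl
    induction l with
    | nil => simp [ℓ1]
    | cons s l ih =>
      rw [List.prod_cons, List.length_cons]
      obtain ⟨x, t, ht, rfl⟩ : ∃ (x : V) (t : G x), wordLength (S x) t ≤ 1 ∧ of Λ G x t = s := by
        rcases hlS s (by simp) with h | h
        · obtain ⟨x, t, ht, rfl⟩ := Set.mem_iUnion.1 h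
          exact ⟨x, t, wordLength_le_one (Or.inl ht), rfl⟩
        · obtain ⟨x, t, ht, hts⟩ := Set.mem_iUnion.1 h
          exact ⟨x, t⁻¹, wordLength_le_one (Or.inr (by simpa using ht)), by simp [hts]⟩
      exact (hstep x t _ ht).trans (Nat.succ_le_succ (ih fun a ha => hlS a (by simp [ha])))
  have hof : ∀ (x : V) (g : G x), len (Λ := Λ) S (of Λ G x g) ≤ wordLength (S x) g := by
    intro x g
    obtain ⟨l, hl, hlS, rfl⟩ := exists_geodesic_word (hS x) g
    rw [← hl, map_list_prod, ← List.length_map (of Λ G x)]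
    refine wordLength_le fun s hs => ?_
    obtain ⟨t, ht, rfl⟩ := List.mem_map.1 hs
    rcases hlS t ht with h | h
    · exact Or.inl (Set.mem_iUnion.2 ⟨x, t, h, rfl⟩)
    · exact Or.inr (Set.mem_iUnion.2 ⟨x, t⁻¹, h, by simp⟩)
  have hge : ∀ w, len S w ≤ ℓ w := fun w => by
    have hw : w ∈ parabolic Λ G Set.univ := by
      rw [parabolic_univ]
      trivial
    refine parabolic_induction (P := fun w => len S w ≤ ℓ w) (by simp [len, wordLength_one])
      (fun x _ g _ w _ hw ih => ?_) hw
    rw [ℓmul _ _ _ hw]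
    exact (wordLength_mul_le hgen _ _).trans (add_le_add (hof x g) ih)
  have heq : ∀ w, len S w = ℓ w := fun w => le_antisymm (hge w) (hle w)
  refine ⟨fun x g => ?_, fun x g w hw => by rw [heq, heq, ℓmul _ _ _ hw]⟩
  have := ℓmul x g 1 (head_one x)
  rwa [mul_one, ← heq, ℓ1, add_zero] at this

theorem len_of [Finite V] (hS : ∀ x, Subgroup.closure (S x) = ⊤) (x : V) (g : G x) :
    len (Λ := Λ) S (of Λ G x g) = wordLength (S x) g := (exists_len hS).1 x g

theorem len_of_mul [Finite V] (hS : ∀ x, Subgroup.closure (S x) = ⊤) {x : V} (g : G x)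
    {w : GraphProduct Λ G} (hw : head x w = 1) :
    len S (of Λ G x g * w) = wordLength (S x) g + len S w := (exists_len hS).2 x g w hw

theorem len_one : len S (1 : GraphProduct Λ G) = 0 := wordLength_one

theorem len_mul_le (hS : ∀ x, Subgroup.closure (S x) = ⊤) (v w : GraphProduct Λ G) :
    len S (v * w) ≤ len S v + len S w := wordLength_mul_le (closure_standardGenerators hS) v w

theorem finite_len_eq [Finite V] (hf : ∀ x, (S x).Finite) (hS : ∀ x, Subgroup.closure (S x) = ⊤)
    (n : ℕ) : {w : GraphProduct Λ G | len S w = n}.Finite :=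
  finite_wordSphere (standardGenerators_finite hf) (closure_standardGenerators hS) n

end GraphProduct

/-! ### Growth series -/

section GrowthSeries

variable {α : Type*}

/-- The growth series of a set `A` with respect to a length function `ℓ`. -/
noncomputable def growthSeries (ℓ : α → ℕ) (A : Set α) : PowerSeries ℕ :=
  PowerSeries.mk fun n => {a ∈ A | ℓ a = n}.ncard

theorem coeff_growthSeries (ℓ : α → ℕ) (A : Set α) (n : ℕ) :
    PowerSeries.coeff n (growthSeries ℓ A) = {a ∈ A | ℓ a = n}.ncard :=
  PowerSeries.coeff_mk _ _

theorem growthSeries_union {ℓ : α → ℕ} (hfin : ∀ n, {a | ℓ a = n}.Finite) {A B : Set α}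
    (hAB : Disjoint A B) : growthSeries ℓ (A ∪ B) = growthSeries ℓ A + growthSeries ℓ B := by
  ext n
  rw [map_add, coeff_growthSeries, coeff_growthSeries, coeff_growthSeries, 
    ← Set.ncard_union_eq (hAB.mono (fun a h => h.1) fun a h => h.1)
      ((hfin n).subset fun a h => h.2) ((hfin n).subset fun a h => h.2)]
  congr 1
  ext a
  simp only [Set.mem_union, Set.mem_ofPred_eq]
  tauto

theorem growthSeries_singleton {ℓ : α → ℕ} {a : α} (ha : ℓ a = 0) : growthSeries ℓ {a} = 1 := by
  ext n
  rw [coeff_growthSeries, PowerSeries.coeff_one]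
  split_ifs with hn
  · have : {b ∈ ({a} : Set α) | ℓ b = n} = {a} := by
      ext b
      simp only [Set.mem_singleton_iff, Set.mem_ofPred_eq, and_iff_left_iff_imp]
      rintro rfl
      rw [ha, hn]
    rw [this, Set.ncard_singleton]
  · have : {b ∈ ({a} : Set α) | ℓ b = n} = ∅ := by
      ext b
      simp only [Set.mem_singleton_iff, Set.mem_ofPred_eq, Set.mem_empty_iff_false, iff_false]
      rintro ⟨rfl, h⟩
      exact hn (by rw [← h, ha])
    rw [this, Set.ncard_empty]

theorem growthSeries_mul {ℓ : α → ℕ} (hfin : ∀ n, {a | ℓ a = n}.Finite) {f : α → α → α}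
    {A B C : Set α} (hbij : Set.BijOn (fun p : α × α => f p.1 p.2) (A ×ˢ B) C)
    (hadd : ∀ a ∈ A, ∀ b ∈ B, ℓ (f a b) = ℓ a + ℓ b) :
    growthSeries ℓ C = growthSeries ℓ A * growthSeries ℓ B := by
  classical
  ext n
  rw [PowerSeries.coeff_mul]
  simp only [coeff_growthSeries]
  set D : Set (α × α) := {p ∈ A ×ˢ B | ℓ p.1 + ℓ p.2 = n} with hD
  have hDfin : D.Finite := by
    refine ((Set.finite_Iic n).biUnion fun i _ => hfin i).prod
      ((Set.finite_Iic n).biUnion fun i _ => hfin i) |>.subset ?_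
    rintro ⟨a, b⟩ ⟨-, h⟩
    simp only at h
    refine ⟨?_, ?_⟩ <;>
    · simp only [Set.mem_iUnion, Set.mem_ofPred_eq, Set.mem_Iic, exists_prop, exists_eq_right']
      omega
  have h1 : {c ∈ C | ℓ c = n} = (fun p : α × α => f p.1 p.2) '' D := by
    ext c
    constructor
    · rintro ⟨hc, hcn⟩
      obtain ⟨p, hp, rfl⟩ := hbij.surjOn hc
      exact ⟨p, ⟨hp, by rw [← hadd _ hp.1 _ hp.2]; exact hcn⟩, rfl⟩
    · rintro ⟨p, ⟨hp, hpn⟩, rfl⟩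
      exact ⟨hbij.mapsTo hp, by rw [← hpn]; exact hadd _ hp.1 _ hp.2⟩
  rw [h1, Set.InjOn.ncard_image (hbij.injOn.mono fun p hp => hp.1),
    Set.ncard_eq_toFinset_card D hDfin,
    Finset.card_eq_sum_card_fiberwise (f := fun p : α × α => (ℓ p.1, ℓ p.2))
      (t := Finset.HasAntidiagonal.antidiagonal n) (by
        intro p hp
        have hp' : p ∈ D := by simpa using hp
        simpa using hp'.2)]
  refine Finset.sum_congr rfl fun ij hij => ?_
  rw [← Set.ncard_prod, ← Set.ncard_coe_finset]
  congr 1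
  ext ⟨a, b⟩
  obtain ⟨i, j⟩ := ij
  simp only [Finset.HasAntidiagonal.mem_antidiagonal] at hij
  simp only [hD, Finset.coe_filter, Set.Finite.mem_toFinset, Set.mem_prod, Set.mem_ofPred_eq,
    Prod.mk.injEq]
  constructor
  · rintro ⟨⟨⟨ha, hb⟩, -⟩, hi, hj⟩
    exact ⟨⟨ha, hi⟩, hb, hj⟩
  · rintro ⟨⟨ha, hi⟩, hb, hj⟩
    exact ⟨⟨⟨ha, hb⟩, by omega⟩, hi, hj⟩

end GrowthSeries

/-! ### The growth series of parabolic subgroups of graph products -/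

namespace GraphProduct

variable {V : Type u} {Λ : SimpleGraph V} {G : V → Type v} [∀ x, Group (G x)]
  {S : ∀ x, Set (G x)}

/-- The elements of a parabolic subgroup which do not start with a syllable at a vertex in `L`:
the shortest representatives of the right cosets of the parabolic subgroup of `L`. -/
def cosetReps (Λ : SimpleGraph V) (G : V → Type v) [∀ x, Group (G x)] (U L : Set V) :
    Set (GraphProduct Λ G) :=
  {w | w ∈ parabolic Λ G U ∧ ∀ x ∈ L, head x w = 1}

/-- The nontrivial elements of a vertex group. -/
def syllables (Λ : SimpleGraph V) (G : V → Type v) [∀ x, Group (G x)] (x : V) :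
    Set (GraphProduct Λ G) :=
  of Λ G x '' {g | g ≠ 1}

/-- A factor `q` without heads in `L` is invisible to the rules for heads at vertices of `L`. Hence
the reduced word of `l` stays reduced in front of `q`, and lengths add. -/
theorem head_mul_and_len_mul [Finite V] (hS : ∀ x, Subgroup.closure (S x) = ⊤) {L : Set V}
    {q : GraphProduct Λ G} (hq : ∀ x ∈ L, head x q = 1) {l : GraphProduct Λ G}
    (hl : l ∈ parabolic Λ G L) :
    (∀ x ∈ L, head x (l * q) = head x l) ∧ len S (l * q) = len S l + len S q := by
  refine parabolic_induction
    (P := fun l => (∀ x ∈ L, head x (l * q) = head x l) ∧ len S (l * q) = len S l + len S q)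
    ⟨fun x hx => by rw [one_mul, hq x hx, head_one], by rw [one_mul, len_one, zero_add]⟩
    (fun y hy g hg l hl hhead ih => ⟨fun x hx => ?_, ?_⟩) hl
  · rw [mul_assoc]
    by_cases hxy : x = y
    · subst hxy
      rw [head_of_mul_self, head_of_mul_self, ih.1 x hx]
    · by_cases hadj : Λ.Adj x y
      · rw [head_of_mul_adj hadj, head_of_mul_adj hadj, ih.1 x hx]
      · rw [head_of_mul_not_adj hxy hadj, head_of_mul_not_adj hxy hadj]
        · rwa [hhead, mul_one]
        · rwa [ih.1 y hy, hhead, mul_one]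
  · rw [mul_assoc, len_of_mul hS g (by rw [ih.1 y hy, hhead]), ih.2, len_of_mul hS g hhead,
      add_assoc]

theorem exists_strip [Finite V] (hS : ∀ x, Subgroup.closure (S x) = ⊤) {U L : Set V}
    (hL : L ⊆ U) (n : ℕ) : ∀ w ∈ parabolic Λ G U, len S w = n →
      ∃ l ∈ parabolic Λ G L, ∃ q ∈ cosetReps Λ G U L, l * q = w := by
  induction n using Nat.strong_induction_on with
  | _ n ih =>
    intro w hw hn
    by_cases h : ∀ x ∈ L, head x w = 1
    · exact ⟨1, one_mem _, w, ⟨hw, h⟩, one_mul w⟩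
    · push Not at h
      obtain ⟨x, hx, hne⟩ := h
      have h1 := len_of_mul hS (head x w) (head_strip x w)
      rw [of_head_mul_strip, hn] at h1
      have h2 : wordLength (S x) (head x w) ≠ 0 := fun h => hne ((wordLength_eq_zero (hS x)).1 h)
      obtain ⟨l, hl, q, hq, hlq⟩ := ih _ (by omega) (of Λ G x (head x w)⁻¹ * w)
        (mul_mem (of_mem_parabolic (hL hx) _) hw) rfl
      refine ⟨of Λ G x (head x w) * l, mul_mem (of_mem_parabolic hx _) hl, q, hq, ?_⟩
      rw [mul_assoc, hlq, of_head_mul_strip]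

theorem growthSeries_parabolic_eq [Finite V] (hf : ∀ x, (S x).Finite)
    (hS : ∀ x, Subgroup.closure (S x) = ⊤) {U L : Set V} (hL : L ⊆ U) :
    growthSeries (len S) (parabolic Λ G U : Set (GraphProduct Λ G)) =
      growthSeries (len S) (parabolic Λ G L : Set (GraphProduct Λ G)) *
        growthSeries (len S) (cosetReps Λ G U L) := by
  refine growthSeries_mul (f := fun a b => a * b) (finite_len_eq hf hS) ⟨?_, ?_, ?_⟩
    fun l hl q hq => (head_mul_and_len_mul hS hq.2 hl).2
  · rintro ⟨l, q⟩ ⟨hl, hq⟩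
    exact mul_mem (parabolic_mono hL hl) hq.1
  · rintro ⟨l, q⟩ ⟨hl, hq⟩ ⟨l', q'⟩ ⟨hl', hq'⟩ heq
    simp only at heq hl hl' hq hq'
    have hm : l'⁻¹ * l ∈ parabolic Λ G L := mul_mem (inv_mem hl') hl
    have hmq : l'⁻¹ * l * q = q' := by rw [mul_assoc, heq, inv_mul_cancel_left]
    -- If not, this element of the parabolic subgroup of `L` has a head in `L`, which `q' = l'⁻¹ * l
    -- * q` would inherit.
    have h1 : l'⁻¹ * l = 1 := by
      by_contra hne
      obtain ⟨x, hx, hhead⟩ := exists_head_ne_one hm hne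
      rw [← (head_mul_and_len_mul hS hq.2 hm).1 x hx, hmq] at hhead
      exact hhead (hq'.2 x hx)
    rw [h1, one_mul] at hmq
    rw [inv_mul_eq_one] at h1
    rw [h1, hmq]
  · intro w hw
    obtain ⟨l, hl, q, hq, rfl⟩ := exists_strip hS hL _ w hw rfl
    exact ⟨(l, q), ⟨hl, hq⟩, rfl⟩

/-- A nontrivial representative has its only head at `x`. Splitting it off leaves an element with no
head at `x` or at its neighbours in `W`; heads at the other vertices of `W` are allowed because a
syllable at `x` hides them. -/
theorem growthSeries_cosetReps_insert [Finite V] (hf : ∀ x, (S x).Finite)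
    (hS : ∀ x, Subgroup.closure (S x) = ⊤) {W : Set V} {x : V} (hx : x ∉ W) :
    growthSeries (len S) (cosetReps Λ G (insert x W) W) =
      1 + growthSeries (len S) (syllables Λ G x) *
        growthSeries (len S) (cosetReps Λ G (insert x W) (insert x (W ∩ {y | Λ.Adj x y}))) := by
  set Q := cosetReps Λ G (insert x W) (insert x (W ∩ {y | Λ.Adj x y})) with hQ
  have h1 : cosetReps Λ G (insert x W) W = {1} ∪ (cosetReps Λ G (insert x W) W \ {1}) := by
    rw [Set.union_sdiff_cancel]
    exact Set.singleton_subset_iff.2 ⟨one_mem _, fun y _ => head_one y⟩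
  rw [h1, growthSeries_union (finite_len_eq hf hS) Set.disjoint_sdiff_right,
    growthSeries_singleton len_one]
  congr 1
  refine growthSeries_mul (f := fun a b => a * b) (finite_len_eq hf hS) ⟨?_, ?_, ?_⟩ ?_
  · rintro ⟨_, r⟩ ⟨⟨g, hg, rfl⟩, hr⟩
    have hrx : head x r = 1 := hr.2 x (Set.mem_insert _ _)
    refine ⟨⟨mul_mem (of_mem_parabolic (Set.mem_insert _ _) g) hr.1, fun y hy => ?_⟩, fun h => ?_⟩
    · have hyx : y ≠ x := by
        rintro rfl
        exact hx hy
      by_cases hadj : Λ.Adj y x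
      · simp only
        rw [head_of_mul_adj hadj]
        exact hr.2 y (Or.inr ⟨hy, hadj.symm⟩)
      · exact head_of_mul_not_adj hyx hadj (by rwa [hrx, mul_one])
    · have h2 := head_of_mul_self x g r
      rw [hrx, mul_one] at h2
      simp only [Set.mem_singleton_iff] at h
      rw [h, head_one] at h2
      exact hg h2.symm
  · rintro ⟨_, r⟩ ⟨⟨g, hg, rfl⟩, hr⟩ ⟨_, r'⟩ ⟨⟨g', hg', rfl⟩, hr'⟩ heq
    simp only at heq
    have h2 := head_of_mul_self x g r
    rw [heq, head_of_mul_self, hr.2 x (Set.mem_insert _ _), hr'.2 x (Set.mem_insert _ _), mul_one,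
      mul_one] at h2
    subst h2
    rw [mul_left_cancel heq]
  · rintro q ⟨hq, hq1⟩
    obtain ⟨y, hy, hne⟩ := exists_head_ne_one hq.1 hq1
    have hyx : y = x := by
      rcases hy with rfl | hy
      · rfl
      · exact absurd (hq.2 y hy) hne
    subst hyx
    refine ⟨(of Λ G y (head y q), of Λ G y (head y q)⁻¹ * q), ⟨⟨_, hne, rfl⟩, ?_, ?_⟩,
      of_head_mul_strip y q⟩
    · exact mul_mem (of_mem_parabolic (Set.mem_insert _ _) _) hq.1
    · rintro z (rfl | ⟨hz, hadj⟩)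
      · exact head_strip _ q
      · rw [head_of_mul_adj hadj.symm]
        exact hq.2 z hz
  · rintro _ ⟨g, hg, rfl⟩ r hr
    rw [len_of_mul hS g (hr.2 x (Set.mem_insert _ _)), len_of hS]

/-- The nontrivial coset representatives. -/
def nontrivialReps (Λ : SimpleGraph V) (G : V → Type v) [∀ x, Group (G x)] (U L : Set V) :
    Set (GraphProduct Λ G) :=
  cosetReps Λ G U L \ {1}

theorem growthSeries_cosetReps [Finite V] (hf : ∀ x, (S x).Finite)
    (hS : ∀ x, Subgroup.closure (S x) = ⊤) (U L : Set V) :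
    growthSeries (len S) (cosetReps Λ G U L) =
      1 + growthSeries (len S) (nontrivialReps Λ G U L) := by
  have h1 : cosetReps Λ G U L = {1} ∪ nontrivialReps Λ G U L := by
    rw [nontrivialReps, Set.union_sdiff_cancel]
    exact Set.singleton_subset_iff.2 ⟨one_mem _, fun y _ => head_one y⟩
  nth_rewrite 1 [h1]
  rw [nontrivialReps, growthSeries_union (finite_len_eq hf hS) Set.disjoint_sdiff_right,
    growthSeries_singleton len_one]

/-- The renewal equation for the growth series of a graph product. -/
theorem growthSeries_parabolic_insert [Finite V] (hf : ∀ x, (S x).Finite)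
    (hS : ∀ x, Subgroup.closure (S x) = ⊤) {W : Set V} {x : V} (hx : x ∉ W) :
    growthSeries (len S) (parabolic Λ G (insert x W) : Set (GraphProduct Λ G)) =
      (1 + growthSeries (len S) (syllables Λ G x)) *
        growthSeries (len S) (parabolic Λ G W : Set (GraphProduct Λ G)) +
      growthSeries (len S) (syllables Λ G x) *
        growthSeries (len S) (nontrivialReps Λ G W (W ∩ {y | Λ.Adj x y})) *
        growthSeries (len S) (parabolic Λ G (insert x W) : Set (GraphProduct Λ G)) := by
  set L := W ∩ {y | Λ.Adj x y} with hL
  have hLW : L ⊆ W := Set.inter_subset_left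
  have hxL : x ∉ L := fun h => hx h.1
  have hLL : L ∩ {y | Λ.Adj x y} = L := Set.inter_eq_left.2 Set.inter_subset_right
  have h1 := growthSeries_parabolic_eq (Λ := Λ) hf hS (Set.subset_insert x W)
  rw [growthSeries_cosetReps_insert hf hS hx] at h1
  have h2 := growthSeries_parabolic_eq (Λ := Λ) hf hS (Set.insert_subset_insert (a := x) hLW)
  have h3 := growthSeries_parabolic_eq (Λ := Λ) hf hS (Set.subset_insert x L)
  rw [growthSeries_cosetReps_insert hf hS hxL, hLL] at h3
  have h4 : cosetReps Λ G (insert x L) (insert x L) = {1} := by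
    ext w
    refine ⟨fun hw => ?_, fun hw => ?_⟩
    · by_contra hne
      obtain ⟨y, hy, h⟩ := exists_head_ne_one hw.1 hne
      exact h (hw.2 y hy)
    · rw [Set.mem_singleton_iff.1 hw]
      exact ⟨one_mem _, fun y _ => head_one y⟩
  rw [h4, growthSeries_singleton len_one, mul_one] at h3
  have h5 := growthSeries_parabolic_eq (Λ := Λ) hf hS hLW
  rw [growthSeries_cosetReps hf hS] at h5
  rw [← hL] at h1
  generalize growthSeries (len S) (parabolic Λ G (insert x W) : Set (GraphProduct Λ G)) = U at *
  generalize growthSeries (len S) (parabolic Λ G (insert x L) : Set (GraphProduct Λ G)) = UL at *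
  generalize growthSeries (len S) (parabolic Λ G W : Set (GraphProduct Λ G)) = PW at *
  generalize growthSeries (len S) (parabolic Λ G L : Set (GraphProduct Λ G)) = PL at *
  generalize growthSeries (len S) (syllables Λ G x) = a at *
  generalize growthSeries (len S) (nontrivialReps Λ G W L) = B at *
  generalize growthSeries (len S) (cosetReps Λ G (insert x W) (insert x L)) = Q at *
  subst h3 h5
  -- From `U = PW (1 + a Q)`, `PW = PL (1 + B)` and `U = PL (1 + a) Q`, multiplication by `1 + a`
  -- allows `Q` to be eliminated. With natural coefficients there is no subtraction, so the surplus
  -- `a * U` is kept on both sides and cancelled coefficientwise.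
  have h6 : U + a * U = ((1 + a) * (PL * (1 + B)) + a * B * U) + a * U := by
    calc U + a * U = U + a * U := rfl
      _ = (1 + a) * U := by ring
      _ = (1 + a) * (PL * (1 + B) * (1 + a * Q)) := by rw [← h1]
      _ = (1 + a) * (PL * (1 + B)) + a * B * (PL * (1 + a) * Q) + a * (PL * (1 + a) * Q) := by ring
      _ = _ := by rw [← h2]
  ext n
  have h7 := congrArg (PowerSeries.coeff n) h6
  rw [map_add, map_add _ _ (a * U)] at h7
  exact Nat.add_right_cancel h7

/-- An element of length `m + n` of a parabolic subgroup splits into pieces of lengths `m`, `n`. -/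
theorem exists_split [Finite V] (hS : ∀ x, Subgroup.closure (S x) = ⊤) {U : Set V} (m : ℕ) :
    ∀ (n : ℕ) (w : GraphProduct Λ G), w ∈ parabolic Λ G U → len S w = m + n →
      ∃ u ∈ parabolic Λ G U, ∃ v ∈ parabolic Λ G U, u * v = w ∧ len S u = m ∧ len S v = n := by
  induction m with
  | zero => exact fun n w hw hn => ⟨1, one_mem _, w, hw, one_mul w, len_one, by omega⟩
  | succ m ih =>
    intro n w hw hn
    obtain ⟨s, hs, v, hv, rfl, hs1, hsv⟩ : ∃ s ∈ parabolic Λ G U, ∃ v ∈ parabolic Λ G U,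
        s * v = w ∧ len S s = 1 ∧ len S w = len S v + 1 := by
      rcases mem_parabolic_iff.1 hw with _ | ⟨x, hx, g, hg, w, hw', hhead⟩
      · rw [len_one] at hn
        omega
      · obtain ⟨s, h, -, rfl, h1, h2⟩ := exists_eq_mul_of_ne_one (hS x) hg
        refine ⟨of Λ G x s, of_mem_parabolic hx s, of Λ G x h * w,
          mul_mem (of_mem_parabolic hx h) (mem_parabolic_iff.2 hw'), by rw [map_mul, mul_assoc],
          by rw [len_of hS, h1], ?_⟩
        rw [len_of_mul hS _ hhead, len_of_mul hS _ hhead, h2]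
        ring
    obtain ⟨u, hu, v', hv', rfl, hum, hvn⟩ := ih n v hv (by omega)
    refine ⟨s * u, mul_mem hs hu, v', hv', by rw [mul_assoc], ?_, hvn⟩
    have h1 := len_mul_le hS s u
    have h2 := len_mul_le hS (s * u) v'
    rw [mul_assoc] at h2
    omega

theorem coeff_growthSeries_parabolic_add_le [Finite V] (hf : ∀ x, (S x).Finite)
    (hS : ∀ x, Subgroup.closure (S x) = ⊤) (U : Set V) (m n : ℕ) :
    PowerSeries.coeff (m + n)
        (growthSeries (len S) (parabolic Λ G U : Set (GraphProduct Λ G))) ≤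
      PowerSeries.coeff m (growthSeries (len S) (parabolic Λ G U : Set (GraphProduct Λ G))) *
      PowerSeries.coeff n (growthSeries (len S) (parabolic Λ G U : Set (GraphProduct Λ G))) := by
  have hfin := finite_len_eq (Λ := Λ) hf hS
  simp only [coeff_growthSeries]
  rw [← Set.ncard_prod]
  refine le_trans (Set.ncard_le_ncard (t := (fun p : GraphProduct Λ G × GraphProduct Λ G =>
    p.1 * p.2) '' _) ?_ ?_) (Set.ncard_image_le ?_)
  · rintro w ⟨hw, hlen⟩
    obtain ⟨u, hu, v, hv, rfl, h1, h2⟩ := exists_split hS m n w hw hlen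
    exact ⟨(u, v), ⟨⟨hu, h1⟩, hv, h2⟩, rfl⟩
  · exact ((((hfin m).subset fun a h => h.2).prod ((hfin n).subset fun a h => h.2))).image _
  · exact ((hfin m).subset fun a h => h.2).prod ((hfin n).subset fun a h => h.2)

end GraphProduct

/-! ### Evaluation of power series with natural coefficients -/

section Eval

open scoped ENNReal NNReal

/-- The value of a power series with natural coefficients at `t ≥ 0`. -/
noncomputable def evalSeries (f : PowerSeries ℕ) (t : ℝ≥0) : ℝ≥0∞ :=
  ∑' n, ((PowerSeries.coeff n f : ℕ) : ℝ≥0∞) * (t : ℝ≥0∞) ^ n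

variable {f g : PowerSeries ℕ} {t : ℝ≥0}

theorem evalSeries_add (f g : PowerSeries ℕ) (t : ℝ≥0) :
    evalSeries (f + g) t = evalSeries f t + evalSeries g t := by
  simp only [evalSeries, map_add, Nat.cast_add, add_mul, ENNReal.tsum_add]

theorem evalSeries_one (t : ℝ≥0) : evalSeries 1 t = 1 := by
  rw [evalSeries, tsum_eq_single 0]
  · simp
  · intro n hn
    simp [PowerSeries.coeff_one, hn]

theorem evalSeries_mul (f g : PowerSeries ℕ) (t : ℝ≥0) :
    evalSeries (f * g) t = evalSeries f t * evalSeries g t := by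
  have h : ∀ n, ((PowerSeries.coeff n (f * g) : ℕ) : ℝ≥0∞) * (t : ℝ≥0∞) ^ n =
      ∑' p : Finset.HasAntidiagonal.antidiagonal n,
        (((PowerSeries.coeff p.1.1 f : ℕ) : ℝ≥0∞) * (t : ℝ≥0∞) ^ p.1.1) *
        (((PowerSeries.coeff p.1.2 g : ℕ) : ℝ≥0∞) * (t : ℝ≥0∞) ^ p.1.2) := fun n => by
    rw [PowerSeries.coeff_mul, Nat.cast_sum, Finset.sum_mul, Finset.tsum_subtype
      (Finset.HasAntidiagonal.antidiagonal n) (fun p : ℕ × ℕ =>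
        (((PowerSeries.coeff p.1 f : ℕ) : ℝ≥0∞) * (t : ℝ≥0∞) ^ p.1) *
        (((PowerSeries.coeff p.2 g : ℕ) : ℝ≥0∞) * (t : ℝ≥0∞) ^ p.2))]
    refine Finset.sum_congr rfl fun p hp => ?_
    rw [← Finset.HasAntidiagonal.mem_antidiagonal.1 hp, pow_add, Nat.cast_mul]
    ring
  simp only [evalSeries, h]
  rw [← ENNReal.tsum_sigma' fun p : Σ n : ℕ, Finset.HasAntidiagonal.antidiagonal n =>
      (((PowerSeries.coeff p.2.1.1 f : ℕ) : ℝ≥0∞) * (t : ℝ≥0∞) ^ p.2.1.1) *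
        (((PowerSeries.coeff p.2.1.2 g : ℕ) : ℝ≥0∞) * (t : ℝ≥0∞) ^ p.2.1.2),
    ← Finset.HasAntidiagonal.sigmaAntidiagonalEquivProd.symm.tsum_eq, ENNReal.tsum_prod']
  simp only [Finset.HasAntidiagonal.sigmaAntidiagonalEquivProd_symm_apply_snd_coe,
    ENNReal.tsum_mul_left, ENNReal.tsum_mul_right]

theorem evalSeries_mono_left (h : ∀ n, PowerSeries.coeff n f ≤ PowerSeries.coeff n g) (t : ℝ≥0) :
    evalSeries f t ≤ evalSeries g t :=
  ENNReal.tsum_le_tsum fun n => mul_le_mul_left (Nat.cast_le.2 (h n)) _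

theorem evalSeries_mono_right (f : PowerSeries ℕ) {s t : ℝ≥0} (h : s ≤ t) :
    evalSeries f s ≤ evalSeries f t :=
  ENNReal.tsum_le_tsum fun n => mul_le_mul_right (pow_le_pow_left' (ENNReal.coe_le_coe.2 h) n) _

theorem coeff_mul_pow_le_evalSeries (f : PowerSeries ℕ) (t : ℝ≥0) (n : ℕ) :
    ((PowerSeries.coeff n f : ℕ) : ℝ≥0∞) * (t : ℝ≥0∞) ^ n ≤ evalSeries f t :=
  ENNReal.le_tsum n

theorem lowerSemicontinuous_evalSeries (f : PowerSeries ℕ) :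
    LowerSemicontinuous (evalSeries f) :=
  lowerSemicontinuous_tsum fun n => Continuous.lowerSemicontinuous <|
    ENNReal.continuous_const_mul (ENNReal.natCast_ne_top _) |>.comp
      ((ENNReal.continuous_pow n).comp ENNReal.continuous_coe)

/-- A bound to the left of `t` extends to `t`. -/
theorem evalSeries_le_of_forall_lt (f : PowerSeries ℕ) {t : ℝ≥0} (ht : 0 < t) {C : ℝ≥0∞}
    (h : ∀ s < t, evalSeries f s ≤ C) : evalSeries f t ≤ C := by
  by_contra! hlt
  have hev : ∀ᶠ s in 𝓝[<] t, C < evalSeries f s :=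
    (lowerSemicontinuous_evalSeries f t C hlt).filter_mono nhdsWithin_le_nhds
  have : (𝓝[<] t).NeBot := nhdsLT_neBot_of_exists_lt ⟨0, ht⟩
  obtain ⟨s, hs, hst⟩ := (hev.and self_mem_nhdsWithin).exists
  exact absurd (h s hst) (not_le.2 hs)

/-- A submultiplicative series diverges at its radius of convergence. -/
theorem exists_lt_evalSeries_ne_top
    (hf : ∀ m n, PowerSeries.coeff (m + n) f ≤ PowerSeries.coeff m f * PowerSeries.coeff n f)
    (ht : evalSeries f t ≠ ∞) : ∃ s, t < s ∧ evalSeries f s ≠ ∞ := by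
  have h0 := ENNReal.tendsto_atTop_zero_of_tsum_ne_top ht
  obtain ⟨N, hN1, hN⟩ : ∃ N, N ≠ 0 ∧
      ((PowerSeries.coeff N f : ℕ) : ℝ≥0∞) * (t : ℝ≥0∞) ^ N < 1 := by
    obtain ⟨N, h1, h2⟩ := ((h0.eventually (gt_mem_nhds zero_lt_one)).and
      (eventually_ne_atTop 0)).exists
    exact ⟨N, h2, h1⟩
  have hcont : Continuous fun s : ℝ≥0 => ((PowerSeries.coeff N f : ℕ) : ℝ≥0∞) * (s : ℝ≥0∞) ^ N :=
    ENNReal.continuous_const_mul (ENNReal.natCast_ne_top _) |>.comp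
      ((ENNReal.continuous_pow N).comp ENNReal.continuous_coe)
  have hev : ∀ᶠ s : ℝ≥0 in 𝓝[>] t, ((PowerSeries.coeff N f : ℕ) : ℝ≥0∞) * (s : ℝ≥0∞) ^ N < 1 :=
    (hcont.continuousAt.eventually (gt_mem_nhds hN)).filter_mono nhdsWithin_le_nhds
  obtain ⟨s, hs, hts⟩ := (hev.and self_mem_nhdsWithin).exists
  refine ⟨s, hts, ?_⟩
  have : NeZero N := ⟨hN1⟩
  set c : ℕ → ℝ≥0∞ := fun n => ((PowerSeries.coeff n f : ℕ) : ℝ≥0∞) * (s : ℝ≥0∞) ^ n with hc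
  have hsub : ∀ m n, c (m + n) ≤ c m * c n := fun m n => by
    calc c (m + n) ≤ ((PowerSeries.coeff m f * PowerSeries.coeff n f : ℕ) : ℝ≥0∞) *
          (s : ℝ≥0∞) ^ (m + n) := mul_le_mul_left (Nat.cast_le.2 (hf m n)) _
      _ = c m * c n := by
        simp only [hc]
        rw [pow_add, Nat.cast_mul]
        ring
  -- One term `c N < 1` suffices: submultiplicativity bounds the terms in each residue class modulo
  -- `N` by a geometric sequence of ratio `c N`.
  have hq : ∀ q i, c (q * N + i) ≤ c N ^ q * c i := fun q i => by
    induction q with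
    | zero => simp
    | succ q ih =>
      calc c ((q + 1) * N + i) = c (N + (q * N + i)) := by congr 1; ring
        _ ≤ c N * c (q * N + i) := hsub _ _
        _ ≤ c N * (c N ^ q * c i) := mul_le_mul_right ih _
        _ = _ := by rw [pow_succ]; ring
  have hle : evalSeries f s ≤ (∑' q : ℕ, c N ^ q) * ∑ i : Fin N, c i := by
    change ∑' n, c n ≤ _
    rw [← (Nat.divModEquiv N).symm.tsum_eq, ENNReal.tsum_prod']
    rw [← ENNReal.tsum_mul_right]
    refine ENNReal.tsum_le_tsum fun q => ?_
    rw [tsum_fintype, Finset.mul_sum]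
    refine Finset.sum_le_sum fun i _ => ?_
    simpa [Nat.divModEquiv] using hq q i
  refine ne_top_of_le_ne_top (ENNReal.mul_ne_top ?_ ?_) hle
  · rw [ENNReal.tsum_geometric]
    exact ENNReal.inv_ne_top.2 (tsub_pos_of_lt hs).ne'
  · exact (ENNReal.sum_lt_top.2 fun i _ => ENNReal.mul_lt_top (ENNReal.natCast_lt_top _)
      (ENNReal.pow_lt_top ENNReal.coe_lt_top)).ne

theorem hasSum_evalSeries (h : evalSeries f t ≠ ∞) :
    HasSum (fun n => ((PowerSeries.coeff n f : ℕ) : ℝ) * (t : ℝ) ^ n) (evalSeries f t).toReal := by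
  have h1 := ENNReal.hasSum_toReal h
  rw [← ENNReal.tsum_toReal_eq (fun n => ENNReal.mul_ne_top (ENNReal.natCast_ne_top _)
    (ENNReal.pow_ne_top ENNReal.coe_ne_top))] at h1
  simpa [evalSeries] using h1

theorem coeff_mul_coeff_le (f g : PowerSeries ℕ) (i j : ℕ) :
    PowerSeries.coeff i f * PowerSeries.coeff j g ≤ PowerSeries.coeff (i + j) (f * g) := by
  rw [PowerSeries.coeff_mul]
  exact Finset.single_le_sum (f := fun p : ℕ × ℕ =>
    PowerSeries.coeff p.1 f * PowerSeries.coeff p.2 g) (fun _ _ => Nat.zero_le _)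
    (Finset.HasAntidiagonal.mem_antidiagonal.2 (rfl : (i, j).1 + (i, j).2 = i + j))

theorem coeff_zero_mul_eq (f g : PowerSeries ℕ) :
    PowerSeries.coeff 0 (f * g) = PowerSeries.coeff 0 f * PowerSeries.coeff 0 g := by
  simp [PowerSeries.coeff_mul]

/-- A series with a renewal equation `E = g + F * E` and a supercritical delay distribution grows
exactly exponentially. -/
theorem exists_tendsto_of_renewal {E F g : PowerSeries ℕ} (hE : E = g + F * E) {τ ρ : ℝ≥0}
    (hτ : 0 < τ) (hτρ : τ < ρ) (hF1 : evalSeries F τ = 1) (hFρ : evalSeries F ρ ≠ ∞)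
    (hF0 : PowerSeries.coeff 0 F = 0) (hF2 : PowerSeries.coeff 2 F ≠ 0)
    (hF3 : PowerSeries.coeff 3 F ≠ 0) (hg : evalSeries g τ ≠ ∞)
    (hg0 : PowerSeries.coeff 0 g ≠ 0) :
    ∃ c : ℝ, 0 < c ∧
      Tendsto (fun n => ((PowerSeries.coeff n E : ℕ) : ℝ) * (τ : ℝ) ^ n) atTop (𝓝 c) := by
  have hτ' : (0 : ℝ) < τ := by exact_mod_cast hτ
  have hpos : ∀ (f : PowerSeries ℕ) n, 0 ≤ ((PowerSeries.coeff n f : ℕ) : ℝ) * (τ : ℝ) ^ n :=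
    fun f n => by positivity
  have hpos' : ∀ (f : PowerSeries ℕ) n, PowerSeries.coeff n f ≠ 0 →
      0 < ((PowerSeries.coeff n f : ℕ) : ℝ) * (τ : ℝ) ^ n := fun f n h => by
    have : (0 : ℝ) < PowerSeries.coeff n f := by exact_mod_cast Nat.pos_of_ne_zero h
    positivity
  -- Weighting by `τ ^ n` turns `F` into a probability distribution, with an exponential moment at
  -- `R = ρ / τ > 1` because `F` converges at `ρ`.
  refine tendsto_renewal (p := fun n => ((PowerSeries.coeff n F : ℕ) : ℝ) * (τ : ℝ) ^ n)
    (g := fun n => ((PowerSeries.coeff n g : ℕ) : ℝ) * (τ : ℝ) ^ n) (R := ρ / τ) (hpos F) (by simp [hF0])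
    ?_ ?_ ?_ (hpos' F 2 hF2) (hpos' F 3 hF3) (hasSum_evalSeries hg).summable (hpos g)
    (hpos' g 0 hg0) (hpos E) fun n => ?_
  · have := hasSum_evalSeries (f := F) (t := τ) (by simp [hF1])
    rwa [hF1, ENNReal.toReal_one] at this
  · rw [one_lt_div hτ']
    exact_mod_cast hτρ
  · refine (hasSum_evalSeries hFρ).summable.congr fun n => ?_
    rw [div_pow]
    field_simp
  · have h := congrArg (PowerSeries.coeff n) hE
    rw [map_add, PowerSeries.coeff_mul,
      Finset.Nat.sum_antidiagonal_eq_sum_range_succ_mk] at h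
    rw [h]
    push_cast
    rw [add_mul, Finset.sum_mul]
    congr 1
    refine Finset.sum_congr rfl fun k hk => ?_
    have : n = k + (n - k) := by
      have := Finset.mem_range.1 hk
      omega
    nth_rewrite 2 [this]
    rw [pow_add]
    ring

end Eval

/-! ### Exact growth of anticonnected parabolic subgroups -/

section GrowthSeries

variable {α : Type*} {ℓ : α → ℕ}

theorem coeff_growthSeries_ne_zero (hfin : ∀ n, {a | ℓ a = n}.Finite) {A : Set α} {a : α}
    (ha : a ∈ A) : PowerSeries.coeff (ℓ a) (growthSeries ℓ A) ≠ 0 := by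
  rw [coeff_growthSeries]
  exact Set.ncard_ne_zero_of_mem (⟨ha, rfl⟩ : a ∈ {b ∈ A | ℓ b = ℓ a})
    ((hfin _).subset fun b hb => hb.2)

theorem coeff_growthSeries_mono (hfin : ∀ n, {a | ℓ a = n}.Finite) {A B : Set α} (h : A ⊆ B)
    (n : ℕ) :
    PowerSeries.coeff n (growthSeries ℓ A) ≤ PowerSeries.coeff n (growthSeries ℓ B) := by
  rw [coeff_growthSeries, coeff_growthSeries]
  exact Set.ncard_le_ncard (fun a ha => ⟨h ha.1, ha.2⟩) ((hfin n).subset fun b hb => hb.2)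

end GrowthSeries

namespace GraphProduct

open scoped ENNReal NNReal

variable {V : Type u} {Λ : SimpleGraph V} {G : V → Type v} [∀ x, Group (G x)]
  {S : ∀ x, Set (G x)}

/-- The complement of the graph induced on `U` is connected: no proper nonempty part of `U` is
completely joined to the rest of `U`. -/
def IsAnticonnected (Λ : SimpleGraph V) (U : Set V) : Prop :=
  ∀ W, W ⊂ U → W.Nonempty → ∃ x ∈ U, x ∉ W ∧ ∃ y ∈ W, ¬ Λ.Adj x y

variable (S) in
/-- The growth series of a parabolic subgroup, evaluated at `t`. -/
noncomputable def growthValue (Λ : SimpleGraph V) (U : Set V) (t : ℝ≥0) : ℝ≥0∞ :=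
  evalSeries (growthSeries (len S) (parabolic Λ G U : Set (GraphProduct Λ G))) t

theorem one_le_growthValue [Finite V] (hf : ∀ x, (S x).Finite) (hS : ∀ x, Subgroup.closure (S x) = ⊤)
    (U : Set V) (t : ℝ≥0) : 1 ≤ growthValue S Λ U t := by
  have h := coeff_growthSeries_ne_zero (finite_len_eq (Λ := Λ) hf hS)
    (one_mem (parabolic Λ G U))
  rw [len_one] at h
  refine le_trans ?_ (coeff_mul_pow_le_evalSeries _ t 0)
  rw [pow_zero, mul_one]
  exact_mod_cast Nat.one_le_iff_ne_zero.2 h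

theorem growthValue_mono [Finite V] (hf : ∀ x, (S x).Finite) (hS : ∀ x, Subgroup.closure (S x) = ⊤)
    {U W : Set V} (h : U ⊆ W) (t : ℝ≥0) : growthValue S Λ U t ≤ growthValue S Λ W t :=
  evalSeries_mono_left (coeff_growthSeries_mono (finite_len_eq hf hS) (parabolic_mono h)) t

theorem growthValue_empty (t : ℝ≥0) : growthValue (G := G) S Λ ∅ t = 1 := by
  have h : (parabolic Λ G ∅ : Set (GraphProduct Λ G)) = {1} := by simp [parabolic]
  rw [growthValue, h, growthSeries_singleton len_one, evalSeries_one]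

/-- At the radius of convergence of the growth series of an anticonnected parabolic subgroup, the
growth series of the smaller parabolic subgroups converge. -/
theorem growthValue_ne_top_of_ssubset [Finite V] [∀ x, Nontrivial (G x)] (hf : ∀ x, (S x).Finite)
    (hS : ∀ x, Subgroup.closure (S x) = ⊤) {U : Set V} (hU : IsAnticonnected Λ U) {τ : ℝ≥0}
    (hτ : 0 < τ) (hlt : ∀ t < τ, growthValue S Λ U t ≠ ∞) {W : Set V} (hW : W ⊂ U) :
    growthValue S Λ W τ ≠ ∞ := by
  induction hn : W.ncard using Nat.strong_induction_on generalizing W with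
  | _ n ih =>
    rcases W.eq_empty_or_nonempty with rfl | hne
    · simp [growthValue_empty]
    -- The nonadjacent pair makes `L` strictly smaller than `W`, so the induction hypothesis applies
    -- to `L`; it remains to bound the representatives `B`.
    obtain ⟨x, hxU, hxW, y, hyW, hxy⟩ := hU W hW hne
    set L := W ∩ {y | Λ.Adj x y} with hL
    have hLW : L ⊂ W := Set.inter_subset_left.ssubset_of_mem_notMem hyW fun h => hxy h.2
    have hLfin := ih L.ncard (hn ▸ Set.ncard_lt_ncard hLW) (hLW.trans hW) rfl
    have hren := growthSeries_parabolic_insert (Λ := Λ) hf hS hxW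
    have hWL := growthSeries_parabolic_eq (Λ := Λ) hf hS hLW.subset
    rw [growthSeries_cosetReps hf hS] at hWL
    rw [← hL] at hren
    set a := growthSeries (len S) (syllables Λ G x) with ha
    set B := growthSeries (len S) (nontrivialReps Λ G W L) with hB
    -- The renewal equation for `insert x W ⊆ U` gives `F(t) E(t) ≤ E(t)` with `1 ≤ E(t) < ∞`, so
    -- `E(t)` cancels. This bound extends to `τ` by semicontinuity.
    have hFle : ∀ t < τ, evalSeries (a * B) t ≤ 1 := fun t ht => by
      have h1 := congrArg (fun f => evalSeries f t) hren
      simp only [evalSeries_add, evalSeries_mul (a * B)] at h1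
      have h2 : growthValue S Λ (insert x W) t ≠ ∞ :=
        ne_top_of_le_ne_top (hlt t ht)
          (growthValue_mono hf hS (Set.insert_subset hxU hW.subset) t)
      have h3 := one_le_growthValue (Λ := Λ) hf hS (insert x W) t
      by_contra! hgt
      have h4 : evalSeries (a * B) t * growthValue S Λ (insert x W) t ≤
          1 * growthValue S Λ (insert x W) t := by
        rw [one_mul]
        exact le_add_self.trans h1.symm.le
      exact absurd h4 (not_le.2 ((ENNReal.mul_lt_mul_iff_left (zero_lt_one.trans_le h3).ne' h2).2
        hgt))
    have hF := evalSeries_le_of_forall_lt (a * B) hτ hFle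
    rw [evalSeries_mul] at hF
    obtain ⟨g, hg⟩ := exists_wordLength_eq_one (hS x)
    have hapos : evalSeries a τ ≠ 0 := by
      have h1 := coeff_growthSeries_ne_zero (finite_len_eq (Λ := Λ) hf hS)
        (show of Λ G x g ∈ syllables Λ G x from ⟨g, fun h => by simp [h, wordLength_one] at hg, rfl⟩)
      have h2 := coeff_mul_pow_le_evalSeries a τ (len S (of Λ G x g))
      refine (lt_of_lt_of_le ?_ h2).ne'
      refine ENNReal.mul_pos (by exact_mod_cast h1) (pow_ne_zero _ (by exact_mod_cast hτ.ne'))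
    have hBfin : evalSeries B τ ≠ ∞ := fun h => by
      rw [h, ENNReal.mul_top hapos] at hF
      exact absurd hF (by simp)
    rw [growthValue, hWL, evalSeries_mul, evalSeries_add, evalSeries_one]
    exact ENNReal.mul_ne_top hLfin (ENNReal.add_ne_top.2 ⟨ENNReal.one_ne_top, hBfin⟩)

/-- The nontrivial coset representatives have an element of length `1`, starting with `y`. -/
theorem of_mem_nontrivialReps {W L : Set V} {y : V} (hyW : y ∈ W) (hyL : y ∉ L) {g : G y}
    (hg : g ≠ 1) : of Λ G y g ∈ nontrivialReps Λ G W L := by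
  refine ⟨⟨of_mem_parabolic hyW g, fun u hu => ?_⟩, fun h => hg ?_⟩
  · exact head_eq_one_of_notMem (of_mem_parabolic (Set.mem_singleton y) g) (by
      rintro rfl
      exact hyL hu)
  · exact of_injective y (by rw [Set.mem_singleton_iff.1 h, map_one])

/-- The vertex `z` may lie in `L`; the syllable at `y` in front does not commute with it and hides
its head. This provides representatives of length 2. -/
theorem of_mul_of_mem_nontrivialReps {W L : Set V} {y z : V} (hyW : y ∈ W) (hyL : y ∉ L)
    (hzW : z ∈ W) (hyz : z ≠ y) (hadj : ¬ Λ.Adj z y) {g : G y} (hg : g ≠ 1) (h : G z) :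
    of Λ G y g * of Λ G z h ∈ nontrivialReps Λ G W L ∧ head y (of Λ G z h) = 1 := by
  have h1 : head y (of Λ G z h) = 1 :=
    head_eq_one_of_notMem (of_mem_parabolic (Set.mem_singleton z) h) hyz.symm
  have h2 : head y (of Λ G y g * of Λ G z h) = g := by rw [head_of_mul_self, h1, mul_one]
  refine ⟨⟨⟨mul_mem (of_mem_parabolic hyW g) (of_mem_parabolic hzW h), fun u hu => ?_⟩,
    fun h3 => hg ?_⟩, h1⟩
  · by_cases huz : u = z
    · rw [huz]
      exact head_of_mul_not_adj hyz hadj (by rwa [h1, mul_one])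
    · refine head_eq_one_of_notMem (U := {y, z}) (mul_mem (of_mem_parabolic (by simp) g)
        (of_mem_parabolic (by simp) h)) ?_
      rintro (rfl | hz)
      exacts [hyL hu, huz hz]
  · rw [← h2, Set.mem_singleton_iff.1 h3, head_one]

/-- Anticonnected parabolic subgroups have exact exponential growth, if the growth series satisfies
an aperiodicity condition. -/
theorem exists_tendsto_growthSeries [Finite V] [∀ x, Nontrivial (G x)] (hf : ∀ x, (S x).Finite)
    (hS : ∀ x, Subgroup.closure (S x) = ⊤) {U : Set V} (hU : IsAnticonnected Λ U) {x y : V}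
    (hx : x ∈ U) (hy : y ∈ U) (hyx : y ≠ x) (hxy : ¬ Λ.Adj x y)
    (haper : (∃ g : G x, wordLength (S x) g = 2) ∨ ∃ z ∈ U, z ≠ x ∧ z ≠ y ∧ ¬ Λ.Adj z y) :
    ∃ τ : ℝ, 0 < τ ∧ τ < 1 ∧ ∃ c : ℝ, 0 < c ∧ Tendsto (fun n => ((PowerSeries.coeff n
      (growthSeries (len S) (parabolic Λ G U : Set (GraphProduct Λ G))) : ℕ) : ℝ) * τ ^ n)
        atTop (𝓝 c) := by
  have hfin := finite_len_eq (Λ := Λ) hf hS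
  set W := U \ {x} with hW
  have hxW : x ∉ W := fun h => h.2 rfl
  have hyW : y ∈ W := ⟨hy, hyx⟩
  have hins : insert x W = U := by rw [hW, Set.insert_sdiff_self_of_mem hx]
  have hWU : W ⊂ U := Set.sdiff_subset.ssubset_of_mem_notMem hx hxW
  have hxU : {x} ⊂ U := (Set.singleton_subset_iff.2 hx).ssubset_of_mem_notMem hy hyx
  set L := W ∩ {y | Λ.Adj x y} with hL
  have hyL : y ∉ L := fun h => hxy h.2
  have hren := growthSeries_parabolic_insert (Λ := Λ) hf hS hxW
  rw [hins, ← hL] at hren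
  set a := growthSeries (len S) (syllables Λ G x) with ha
  set B := growthSeries (len S) (nontrivialReps Λ G W L) with hB
  set E := growthSeries (len S) (parabolic Λ G U : Set (GraphProduct Λ G)) with hE
  set EW := growthSeries (len S) (parabolic Λ G W : Set (GraphProduct Λ G)) with hEW
  -- small coefficients
  have hne : ∀ {z : V} {g : G z} {n : ℕ}, wordLength (S z) g = n + 1 → g ≠ 1 := by
    rintro z g n hg rfl
    rw [wordLength_one] at hg
    omega
  obtain ⟨gx, hgx⟩ := exists_wordLength_eq_one (hS x)
  obtain ⟨gy, hgy⟩ := exists_wordLength_eq_one (hS y)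
  have ha1 : PowerSeries.coeff 1 a ≠ 0 := by
    have := coeff_growthSeries_ne_zero hfin
      (show of Λ G x gx ∈ syllables Λ G x from ⟨gx, hne hgx, rfl⟩)
    rwa [len_of hS, hgx] at this
  have hB1 : PowerSeries.coeff 1 B ≠ 0 := by
    have := coeff_growthSeries_ne_zero hfin (of_mem_nontrivialReps (Λ := Λ) hyW hyL (hne hgy))
    rwa [len_of hS, hgy] at this
  have hF2 : PowerSeries.coeff 2 (a * B) ≠ 0 := fun h => by
    have := coeff_mul_coeff_le a B 1 1
    rw [h, Nat.le_zero, mul_eq_zero] at this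
    tauto
  -- Degree 3 is obtained as 2 + 1 from a long syllable at `x`, or as 1 + 2 from a representative
  -- starting with `y` and continuing with `z`.
  have hF3 : PowerSeries.coeff 3 (a * B) ≠ 0 := fun h => by
    rcases haper with ⟨g, hg⟩ | ⟨z, hzU, hzx, hzy, hadj⟩
    · have ha2 : PowerSeries.coeff 2 a ≠ 0 := by
        have := coeff_growthSeries_ne_zero hfin
          (show of Λ G x g ∈ syllables Λ G x from ⟨g, hne hg, rfl⟩)
        rwa [len_of hS, hg] at this
      have := coeff_mul_coeff_le a B 2 1
      rw [h, Nat.le_zero, mul_eq_zero] at this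
      tauto
    · obtain ⟨gz, hgz⟩ := exists_wordLength_eq_one (hS z)
      have hB2 : PowerSeries.coeff 2 B ≠ 0 := by
        have h1 := of_mul_of_mem_nontrivialReps (Λ := Λ) hyW hyL ⟨hzU, hzx⟩ hzy hadj (hne hgy) gz
        have := coeff_growthSeries_ne_zero hfin h1.1
        rwa [len_of_mul hS _ h1.2, len_of hS, hgy, hgz] at this
      have := coeff_mul_coeff_le a B 1 2
      rw [h, Nat.le_zero, mul_eq_zero] at this
      tauto
  have ha0 : PowerSeries.coeff 0 a = 0 := by
    rw [ha, coeff_growthSeries, Set.ncard_eq_zero ((hfin 0).subset fun b hb => hb.2)]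
    rw [Set.eq_empty_iff_forall_notMem]
    rintro _ ⟨⟨g, hg, rfl⟩, h0⟩
    rw [len_of hS] at h0
    exact hg ((wordLength_eq_zero (hS x)).1 h0)
  have hF0 : PowerSeries.coeff 0 (a * B) = 0 := by
    rw [coeff_zero_mul_eq, ha0, zero_mul]
  have hE1 : ∀ t, 1 ≤ evalSeries E t := one_le_growthValue hf hS U
  -- the delay distribution is subcritical wherever the growth series converges
  have hEeq : ∀ t, evalSeries E t =
      evalSeries ((1 + a) * EW) t + evalSeries (a * B) t * evalSeries E t := fun t => by
    rw [← evalSeries_mul, ← evalSeries_add, ← hren]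
  have hFle : ∀ t, evalSeries E t ≠ ∞ → evalSeries (a * B) t ≤ 1 := fun t ht => by
    by_contra! hgt
    have h4 : evalSeries (a * B) t * evalSeries E t ≤ 1 * evalSeries E t := by
      rw [one_mul]
      exact le_add_self.trans (hEeq t).symm.le
    exact absurd h4 (not_le.2 ((ENNReal.mul_lt_mul_iff_left
      (zero_lt_one.trans_le (hE1 t)).ne' ht).2 hgt))
  -- The coefficients in degrees 2 and 3 contribute at least 2 at `t = 1`; this keeps the radius of
  -- convergence below 1, that is, the growth rate above 1.
  have hF1 : 1 < evalSeries (a * B) 1 := by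
    refine lt_of_lt_of_le ?_ (ENNReal.sum_le_tsum {2, 3})
    rw [Finset.sum_pair (by norm_num)]
    simp only [ENNReal.coe_one, one_pow, mul_one]
    have : 1 < PowerSeries.coeff 2 (a * B) + PowerSeries.coeff 3 (a * B) := by omega
    exact_mod_cast this
  -- the radius of convergence
  have hsub := coeff_growthSeries_parabolic_add_le (Λ := Λ) hf hS
  set T : Set ℝ≥0 := {t | evalSeries E t ≠ ∞} with hT
  have hTb : ∀ t ∈ T, t ≤ 1 := fun t ht => by
    by_contra! h
    exact absurd (hFle 1 (ne_top_of_le_ne_top ht (evalSeries_mono_right E h.le))) (not_le.2 hF1)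
  have hT0 : (0 : ℝ≥0) ∈ T := by
    have : evalSeries E 0 = PowerSeries.coeff 0 E := by
      rw [evalSeries, tsum_eq_single 0 fun n hn => by simp [hn]]
      simp
    simp [hT, this]
  have hTbdd : BddAbove T := ⟨1, hTb⟩
  set τ := sSup T with hτdef
  -- A submultiplicative series cannot converge at its radius of convergence, since it would
  -- converge beyond.
  have hτT : τ ∉ T := fun h => by
    obtain ⟨s, hs, hsT⟩ := exists_lt_evalSeries_ne_top (hsub U) h
    exact absurd (le_csSup hTbdd (show s ∈ T from hsT)) (not_le.2 hs)
  have hτ0 : 0 < τ := by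
    obtain ⟨s, hs, hsT⟩ := exists_lt_evalSeries_ne_top (hsub U) hT0
    exact hs.trans_le (le_csSup hTbdd hsT)
  have hlt : ∀ t < τ, evalSeries E t ≠ ∞ := fun t ht => by
    obtain ⟨s, hs, hts⟩ := exists_lt_of_lt_csSup ⟨0, hT0⟩ ht
    exact ne_top_of_le_ne_top hs (evalSeries_mono_right E hts.le)
  have hWτ := growthValue_ne_top_of_ssubset hf hS hU hτ0 hlt hWU
  have hxτ := growthValue_ne_top_of_ssubset hf hS hU hτ0 hlt hxU
  -- The series of the proper parabolic subgroups on `W` and `{x}` are finite at `τ` and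
  -- submultiplicative, hence finite past `τ`; they dominate `B` and `a`.
  obtain ⟨ρ₁, hρ₁, hWρ⟩ := exists_lt_evalSeries_ne_top (hsub W) hWτ
  obtain ⟨ρ₂, hρ₂, hxρ⟩ := exists_lt_evalSeries_ne_top (hsub {x}) hxτ
  have hBW : ∀ t, evalSeries B t ≤ evalSeries EW t :=
    evalSeries_mono_left (coeff_growthSeries_mono hfin fun w hw => hw.1.1)
  have hax : ∀ t, evalSeries a t ≤ growthValue S Λ {x} t := fun t =>
    evalSeries_mono_left (coeff_growthSeries_mono hfin (by
      rintro _ ⟨g, -, rfl⟩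
      exact of_mem_parabolic (Set.mem_singleton x) g)) t
  have hFτ := evalSeries_le_of_forall_lt (a * B) hτ0 fun t ht => hFle t (hlt t ht)
  have hgτ : evalSeries ((1 + a) * EW) τ ≠ ∞ := by
    rw [evalSeries_mul, evalSeries_add, evalSeries_one]
    exact ENNReal.mul_ne_top (ENNReal.add_ne_top.2
      ⟨ENNReal.one_ne_top, ne_top_of_le_ne_top hxτ (hax τ)⟩) hWτ
  -- If `F(τ) < 1`, solving the renewal equation bounds `E(t)` by `g(τ) / (1 - F(τ))` for `t < τ`,
  -- with `g = (1 + a) EW`, and then `E` would be finite at `τ`.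
  have hFτ1 : evalSeries (a * B) τ = 1 := by
    refine le_antisymm hFτ (not_lt.1 fun hlt1 => hτT ?_)
    refine ne_top_of_le_ne_top (b := evalSeries ((1 + a) * EW) τ / (1 - evalSeries (a * B) τ))
      (ENNReal.div_ne_top hgτ (tsub_pos_of_lt hlt1).ne') ?_
    refine evalSeries_le_of_forall_lt E hτ0 fun t ht => ?_
    rw [ENNReal.le_div_iff_mul_le (Or.inl (tsub_pos_of_lt hlt1).ne')
      (Or.inl (ne_top_of_le_ne_top ENNReal.one_ne_top tsub_le_self)),
      ENNReal.mul_sub (fun _ _ => hlt t ht), mul_one, tsub_le_iff_right]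
    nth_rewrite 1 [hEeq t]
    refine add_le_add (evalSeries_mono_right _ ht.le) ?_
    rw [mul_comm]
    exact mul_le_mul_right (evalSeries_mono_right _ ht.le) _
  have hτ1 : τ < 1 := by
    refine lt_of_le_of_ne (csSup_le ⟨0, hT0⟩ hTb) fun h => ?_
    rw [h] at hFτ
    exact absurd hFτ (not_le.2 hF1)
  refine ⟨τ, by exact_mod_cast hτ0, by exact_mod_cast hτ1,
    exists_tendsto_of_renewal hren hτ0 (lt_min hρ₁ hρ₂) hFτ1 ?_ hF0 hF2 hF3 hgτ ?_⟩
  · rw [evalSeries_mul]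
    refine ENNReal.mul_ne_top (ne_top_of_le_ne_top hxρ ((hax _).trans
      (evalSeries_mono_right _ (min_le_right _ _)))) (ne_top_of_le_ne_top hWρ ((hBW _).trans
      (evalSeries_mono_right _ (min_le_left _ _))))
  · have h0 := coeff_growthSeries_ne_zero hfin (one_mem (parabolic Λ G W))
    rw [len_one] at h0
    rw [coeff_zero_mul_eq, map_add, ha0, PowerSeries.coeff_zero_one, add_zero, one_mul]
    exact h0

end GraphProduct

/-! ### Anticonnected graphs with at least three vertices -/

namespace GraphProduct

variable {V : Type u} {Λ : SimpleGraph V} {G : V → Type v} [∀ x, Group (G x)]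
  {S : ∀ x, Set (G x)}

theorem hasExactExponentialGrowth_of_tendsto [Finite V] (hf : ∀ x, (S x).Finite)
    (hS : ∀ x, Subgroup.closure (S x) = ⊤)
    (h : ∃ τ : ℝ, 0 < τ ∧ τ < 1 ∧ ∃ c : ℝ, 0 < c ∧ Tendsto (fun n => ((PowerSeries.coeff n
      (growthSeries (len S) (parabolic Λ G Set.univ : Set (GraphProduct Λ G))) : ℕ) : ℝ) * τ ^ n)
        atTop (𝓝 c)) :
    HasExactExponentialGrowth (standardGenerators Λ S) := by
  obtain ⟨τ, hτ0, hτ1, c, hc, hlim⟩ := h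
  refine ⟨standardGenerators_finite hf, closure_standardGenerators hS, τ⁻¹,
    (one_lt_inv₀ hτ0).2 hτ1, c, hc, hlim.congr fun n => ?_⟩
  rw [coeff_growthSeries, parabolic_univ, inv_pow, div_inv_eq_mul]
  simp [wordSphere, len]

/-- A walk of the complement graph from inside `W` to outside must cross its boundary. -/
theorem isAnticonnected_univ (h : Λᶜ.Connected) : IsAnticonnected Λ Set.univ := by
  intro W hW hne
  obtain ⟨y, hy⟩ := hne
  obtain ⟨x, -, hx⟩ := Set.exists_of_ssubset hW
  obtain ⟨p⟩ := h.preconnected y x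
  obtain ⟨d, -, hd1, hd2⟩ := p.exists_boundary_dart W hy hx
  exact ⟨d.snd, trivial, hd2, d.fst, hd1, fun hadj => ((SimpleGraph.compl_adj _ _ _).1 d.adj).2
    hadj.symm⟩

/-- An anticonnected set with at least three vertices contains a path of length two of the
complement graph. -/
theorem IsAnticonnected.exists_path {U : Set V} (hU : IsAnticonnected Λ U) (h3 : 3 ≤ U.ncard) :
    ∃ x ∈ U, ∃ y ∈ U, ∃ z ∈ U, y ≠ x ∧ z ≠ x ∧ z ≠ y ∧ ¬ Λ.Adj x y ∧ ¬ Λ.Adj z y := by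
  obtain ⟨a, ha⟩ := Set.nonempty_of_ncard_ne_zero (s := U) (by omega)
  have h1 : ({a} : Set V) ⊂ U := by
    refine (Set.singleton_subset_iff.2 ha).ssubset_of_ne ?_
    rintro rfl
    rw [Set.ncard_singleton] at h3
    omega
  obtain ⟨b, hb, hba, _, rfl, hab⟩ := hU _ h1 (Set.singleton_nonempty a)
  rename_i a
  have hba' : b ≠ a := hba
  have h2 : ({a, b} : Set V) ⊂ U := by
    refine (Set.insert_subset ha (Set.singleton_subset_iff.2 hb)).ssubset_of_ne ?_
    rintro rfl
    rw [Set.ncard_pair hba'.symm] at h3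
    omega
  -- A third vertex is nonadjacent to one of `a`, `b`, and that one becomes the middle of the path.
  obtain ⟨z, hz, hzab, y, hy, hzy⟩ := hU _ h2 (Set.insert_nonempty _ _)
  simp only [Set.mem_insert_iff, Set.mem_singleton_iff, not_or] at hzab
  rcases hy with rfl | hy
  · exact ⟨b, hb, _, ha, z, hz, hba'.symm, hzab.2, hzab.1, hab, hzy⟩
  · rw [Set.mem_singleton_iff] at hy
    subst hy
    exact ⟨a, ha, y, hb, z, hz, hba', hzab.1, hzab.2, fun h => hab h.symm, hzy⟩

theorem exists_tendsto_of_three_le [Finite V] [∀ x, Nontrivial (G x)] (hf : ∀ x, (S x).Finite)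
    (hS : ∀ x, Subgroup.closure (S x) = ⊤) {U : Set V} (hU : IsAnticonnected Λ U)
    (h3 : 3 ≤ U.ncard) :
    ∃ τ : ℝ, 0 < τ ∧ τ < 1 ∧ ∃ c : ℝ, 0 < c ∧ Tendsto (fun n => ((PowerSeries.coeff n
      (growthSeries (len S) (parabolic Λ G U : Set (GraphProduct Λ G))) : ℕ) : ℝ) * τ ^ n)
        atTop (𝓝 c) := by
  obtain ⟨x, hx, y, hy, z, hz, hyx, hzx, hzy, hxy, hzy'⟩ := hU.exists_path h3
  exact exists_tendsto_growthSeries hf hS hU hx hy hyx hxy (Or.inr ⟨z, hz, hzx, hzy, hzy'⟩)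

theorem hasExactExponentialGrowth [Finite V] [∀ x, Nontrivial (G x)] (hf : ∀ x, (S x).Finite)
    (hS : ∀ x, Subgroup.closure (S x) = ⊤) (hΛ : Λᶜ.Connected) (h3 : 3 ≤ Nat.card V) :
    HasExactExponentialGrowth (standardGenerators Λ S) :=
  hasExactExponentialGrowth_of_tendsto hf hS (exists_tendsto_of_three_le hf hS
    (isAnticonnected_univ hΛ) (by rwa [Set.ncard_univ]))

/-! ### Commuting parabolic subgroups -/

theorem commute_of_mem_parabolic {A B : Set V} (hAB : ∀ a ∈ A, ∀ b ∈ B, Λ.Adj a b)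
    {v w : GraphProduct Λ G} (hv : v ∈ parabolic Λ G A) (hw : w ∈ parabolic Λ G B) :
    Commute v w := by
  have h1 : parabolic Λ G B ≤ Subgroup.centralizer (parabolic Λ G A) := by
    rw [parabolic, Subgroup.closure_le]
    rintro _ ⟨b, hb, h, rfl⟩
    rw [SetLike.mem_coe, parabolic, Subgroup.centralizer_closure, Subgroup.mem_centralizer_iff]
    rintro _ ⟨a, ha, g, rfl⟩
    exact of_mul_of_comm (hAB a ha b hb) g h
  exact Subgroup.mem_centralizer_iff.1 (h1 hw) v hv

/-- The two parabolic subgroups commute and generate. They meet trivially because the heads of a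
common element would have to lie both in `A` and in its complement. -/
theorem isProductOfInfiniteGroups {V : Type u} {Λ : SimpleGraph V} {G : V → Type}
    [∀ x, Group (G x)] {A : Set V} (hAB : ∀ a ∈ A, ∀ b ∉ A, Λ.Adj a b)
    (hA : Infinite (parabolic Λ G A)) (hB : Infinite (parabolic Λ G Aᶜ)) :
    IsProductOfInfiniteGroups (GraphProduct Λ G) := by
  let f := MonoidHom.noncommCoprod (parabolic Λ G A).subtype (parabolic Λ G Aᶜ).subtype
    fun v w => commute_of_mem_parabolic hAB v.2 w.2
  have hf : ∀ p, f p = p.1 * p.2 := fun p => rfl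
  have hinj : Function.Injective f := by
    rw [injective_iff_map_eq_one]
    rintro ⟨v, w⟩ h
    rw [hf] at h
    have hv : (v : GraphProduct Λ G) ∈ parabolic Λ G Aᶜ := by
      rw [eq_inv_of_mul_eq_one_left h]
      exact inv_mem w.2
    have hv1 : (v : GraphProduct Λ G) = 1 := by
      by_contra hne
      obtain ⟨x, hx, hxv⟩ := exists_head_ne_one v.2 hne
      exact hxv (head_eq_one_of_notMem hv fun h => h hx)
    rw [hv1, one_mul] at h
    exact Prod.ext (Subtype.ext hv1) (Subtype.ext h)
  have hsurj : Function.Surjective f := by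
    rw [← MonoidHom.range_eq_top, eq_top_iff, ← parabolic_univ, parabolic, Subgroup.closure_le]
    rintro _ ⟨x, -, g, rfl⟩
    by_cases hx : x ∈ A
    · exact ⟨(⟨_, of_mem_parabolic hx g⟩, 1), by simp [hf]⟩
    · exact ⟨(1, ⟨_, of_mem_parabolic (show x ∈ Aᶜ from hx) g⟩), by simp [hf]⟩
  exact ⟨parabolic Λ G A, parabolic Λ G Aᶜ, inferInstance, inferInstance, hA, hB,
    ⟨(MulEquiv.ofBijective f ⟨hinj, hsurj⟩).symm⟩⟩

theorem infinite_parabolic_of_infinite {A : Set V} {x : V} (hx : x ∈ A) [Infinite (G x)] :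
    Infinite (parabolic Λ G A) :=
  Infinite.of_injective (fun g : G x => (⟨of Λ G x g, of_mem_parabolic hx g⟩ : parabolic Λ G A))
    fun _ _ h => of_injective x (congrArg Subtype.val h)

/-- In the powers of `g h` no two syllables merge, so their lengths grow linearly and they are
distinct. -/
theorem infinite_parabolic_of_not_adj [Finite V] [∀ x, Nontrivial (G x)] {A : Set V} {x y : V}
    (hx : x ∈ A) (hy : y ∈ A) (hne : x ≠ y) (hxy : ¬ Λ.Adj x y) :
    Infinite (parabolic Λ G A) := by
  obtain ⟨g, hg⟩ := exists_ne (1 : G x)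
  obtain ⟨h, hh⟩ := exists_ne (1 : G y)
  have hS : ∀ z, Subgroup.closure (Set.univ : Set (G z)) = ⊤ := fun z => Subgroup.closure_univ
  have key : ∀ n : ℕ, head y ((of Λ G x g * of Λ G y h) ^ n) = 1 ∧
      len (fun _ => Set.univ) ((of Λ G x g * of Λ G y h) ^ n) =
        n * (wordLength Set.univ g + wordLength Set.univ h) := fun n => by
    induction n with
    | zero => simp [head_one, len_one]
    | succ n ih =>
      have h1 : head x (of Λ G y h * (of Λ G x g * of Λ G y h) ^ n) = 1 :=
        head_of_mul_not_adj hne hxy (by rwa [ih.1, mul_one])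
      rw [pow_succ', mul_assoc]
      refine ⟨head_of_mul_not_adj hne.symm (fun h => hxy h.symm) (by rwa [h1, mul_one]), ?_⟩
      rw [len_of_mul hS g h1, len_of_mul hS h ih.1, ih.2]
      ring
  have hpos : 0 < wordLength Set.univ g :=
    Nat.pos_of_ne_zero fun h0 => hg ((wordLength_eq_zero (hS x)).1 h0)
  refine Infinite.of_injective (fun n : ℕ => (⟨(of Λ G x g * of Λ G y h) ^ n,
    pow_mem (mul_mem (of_mem_parabolic hx g) (of_mem_parabolic hy h)) n⟩ : parabolic Λ G A))
    fun m n hmn => ?_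
  have h1 := congrArg (len fun _ => Set.univ) (congrArg Subtype.val hmn)
  simp only [(key _).2] at h1
  exact Nat.eq_of_mul_eq_mul_right (by omega) h1

end GraphProduct

/-- There are finitely many edges, and every element is a product of labels along a path. -/
theorem HasGeodesicCombing.finite_and_closure {G : Type*} [Group G] {S : Set G}
    (h : HasGeodesicCombing S) : S.Finite ∧ Subgroup.closure S = ⊤ := by
  obtain ⟨Γ, hΓ⟩ := h
  have := Γ.finite_edge
  rw [← hΓ.labelSet_eq]
  refine ⟨Set.finite_range _, eq_top_iff.2 fun g _ => ?_⟩
  obtain ⟨p, -, rfl⟩ := hΓ.bijOn.surjOn (Set.mem_univ g)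
  refine Subgroup.list_prod_mem _ fun s hs => ?_
  obtain ⟨e, -, rfl⟩ := List.mem_map.1 hs
  exact Subgroup.subset_closure ⟨e, rfl⟩

/-! ### Transport along isomorphisms -/

section Transport

variable {G H : Type*} [Group G] [Group H]

theorem wordLength_image (e : G ≃* H) (S : Set G) (g : G) :
    wordLength (e '' S) (e g) = wordLength S g := by
  have key : ∀ {G H : Type _} [Group G] [Group H] (e : G ≃* H) (S : Set G) (g : G) (n : ℕ),
      (∃ w : List G, w.length = n ∧ (∀ s ∈ w, s ∈ S ∨ s⁻¹ ∈ S) ∧ w.prod = g) →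
      ∃ w : List H, w.length = n ∧ (∀ s ∈ w, s ∈ e '' S ∨ s⁻¹ ∈ e '' S) ∧ w.prod = e g := by
    rintro G H _ _ e S _ _ ⟨w, rfl, hw, rfl⟩
    refine ⟨w.map e, List.length_map _, fun s hs => ?_, (map_list_prod e w).symm⟩
    obtain ⟨t, ht, rfl⟩ := List.mem_map.1 hs
    rcases hw t ht with h | h
    · exact Or.inl ⟨t, h, rfl⟩
    · exact Or.inr ⟨t⁻¹, h, map_inv e t⟩
  rw [wordLength, wordLength]
  congr 1
  ext n
  refine ⟨fun h => ?_, key e S g n⟩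
  rcases h with ⟨w, hn, hw, hp⟩
  refine ⟨w.map e.symm, by simpa using hn, fun s hs => ?_, by
    rw [← map_list_prod, hp, e.symm_apply_apply]⟩
  obtain ⟨t, ht, rfl⟩ := List.mem_map.1 hs
  rcases hw t ht with ⟨r, hr, h⟩ | ⟨r, hr, h⟩
  · exact Or.inl (by rwa [← h, e.symm_apply_apply])
  · exact Or.inr (by rwa [← map_inv, ← h, e.symm_apply_apply])

theorem HasExactExponentialGrowth.image {S : Set G} (h : HasExactExponentialGrowth S)
    (e : G ≃* H) : HasExactExponentialGrowth (e '' S) := by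
  obtain ⟨hf, hS, lam, hlam, c, hc, hlim⟩ := h
  refine ⟨hf.image e, ?_, lam, hlam, c, hc, hlim.congr fun n => ?_⟩
  · have h1 := MonoidHom.map_closure e.toMonoidHom S
    rw [hS, ← MonoidHom.range_eq_map, MonoidHom.range_eq_top.2 e.surjective] at h1
    exact h1.symm
  · have h1 : wordSphere (e '' S) n = e '' wordSphere S n := by
      ext h
      obtain ⟨g, rfl⟩ := e.surjective h
      simp [wordSphere, wordLength_image]
    rw [h1, Set.ncard_image_of_injective _ e.injective]

theorem IsVirtuallyCyclic.of_mulEquiv (h : IsVirtuallyCyclic G) (e : G ≃* H) :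
    IsVirtuallyCyclic H := by
  obtain ⟨K, hK, hKc⟩ := h
  refine ⟨K.map e.toMonoidHom, ?_, ?_⟩
  · exact ⟨by
      rw [Subgroup.index_map_of_bijective (f := e.toMonoidHom) e.bijective]
      exact hK.index_ne_zero⟩
  · exact isCyclic_of_surjective (e.toMonoidHom.subgroupMap K)
      (e.toMonoidHom.subgroupMap_surjective K)

end Transport

theorem IsProductOfInfiniteGroups.of_mulEquiv {G H : Type u} [Group G] [Group H]
    (h : IsProductOfInfiniteGroups G) (e : G ≃* H) : IsProductOfInfiniteGroups H := by
  obtain ⟨A, B, _, _, hA, hB, ⟨f⟩⟩ := h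
  exact ⟨A, B, inferInstance, inferInstance, hA, hB, ⟨e.symm.trans f⟩⟩

/-! ### Right-angled Artin groups as graph products -/

namespace GraphProduct

/-- Since `h₀` generates `H`, maps out of the graph product are determined on the elements `h₀` of
the vertex groups, and the commutators of vertices imply those of all their powers. -/
theorem exists_mulEquiv_presentedGroup {V : Type u} (Λ : SimpleGraph V) {H : Type v} [Group H]
    {h₀ : H} (hH : ∀ h : H, ∃ k : ℤ, h₀ ^ k = h) {rels : Set (FreeGroup V)}
    (φ : V → H →* PresentedGroup rels) (hφ : ∀ x, φ x h₀ = PresentedGroup.of x)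
    (hrels : ∀ r ∈ rels, FreeGroup.lift (fun x => of Λ (fun _ => H) x h₀) r = 1)
    (hadj : ∀ x y, Λ.Adj x y →
      Commute (PresentedGroup.of (rels := rels) x) (PresentedGroup.of (rels := rels) y)) :
    ∃ e : GraphProduct Λ (fun _ : V => H) ≃* PresentedGroup rels,
      ∀ x, e (of Λ (fun _ => H) x h₀) = PresentedGroup.of x := by
  let f : PresentedGroup rels →* GraphProduct Λ (fun _ : V => H) :=
    PresentedGroup.toGroup (f := fun x => of Λ (fun _ => H) x h₀) hrels
  let g : GraphProduct Λ (fun _ : V => H) →* PresentedGroup rels :=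
    QuotientGroup.lift _ (Monoid.CoprodI.lift φ) (by
      refine Subgroup.normalClosure_le_normal ?_
      rintro r ⟨x, y, g, h, hxy, rfl⟩
      obtain ⟨k, rfl⟩ := hH g
      obtain ⟨l, rfl⟩ := hH h
      rw [SetLike.mem_coe, MonoidHom.mem_ker]
      simp only [map_mul, map_inv, Monoid.CoprodI.lift_of, map_zpow, hφ]
      rw [(((hadj x y hxy).zpow_left k).zpow_right l).eq, mul_inv_cancel_right, mul_inv_cancel])
  have hg : ∀ x h, g (of Λ (fun _ => H) x h) = φ x h := fun x h => by
    simp [g, of]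
  have hf : ∀ x, f (PresentedGroup.of x) = of Λ (fun _ => H) x h₀ := fun x =>
    PresentedGroup.toGroup.of hrels
  have h1 : g.comp f = MonoidHom.id _ := by
    ext x
    simp [hf, hg, hφ]
  have h2 : f.comp g = MonoidHom.id _ := by
    refine QuotientGroup.monoidHom_ext _ (Monoid.CoprodI.ext_hom _ _ fun x => ?_)
    ext h
    obtain ⟨k, rfl⟩ := hH h
    change f (g (of Λ (fun _ => H) x (h₀ ^ k))) = of Λ (fun _ => H) x (h₀ ^ k)
    rw [map_zpow, map_zpow, map_zpow, hg, hφ, hf]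
  exact ⟨MonoidHom.toMulEquiv g f h2 h1, fun x => (hg x h₀).trans (hφ x)⟩

theorem image_standardGenerators {V : Type u} {Λ : SimpleGraph V} {H : Type v} [Group H] {h₀ : H}
    {rels : Set (FreeGroup V)} (e : GraphProduct Λ (fun _ : V => H) ≃* PresentedGroup rels)
    (he : ∀ x, e (of Λ (fun _ => H) x h₀) = PresentedGroup.of x) :
    e '' standardGenerators Λ (fun _ => {h₀, h₀⁻¹}) = vertexGenerators rels := by
  ext w
  simp only [standardGenerators, Set.mem_image, Set.mem_iUnion, Set.mem_insert_iff,
    Set.mem_singleton_iff, vertexGenerators]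
  constructor
  · rintro ⟨_, ⟨x, h, rfl | rfl, rfl⟩, rfl⟩
    · exact ⟨x, Or.inl (he x)⟩
    · exact ⟨x, Or.inr (by rw [map_inv, map_inv, he])⟩
  · rintro ⟨x, rfl | rfl⟩
    · exact ⟨_, ⟨x, h₀, Or.inl rfl, rfl⟩, he x⟩
    · exact ⟨_, ⟨x, h₀⁻¹, Or.inr rfl, rfl⟩, by rw [map_inv, map_inv, he]⟩

theorem closure_pair_inv {H : Type*} [Group H] {h₀ : H} (hH : ∀ h : H, ∃ k : ℤ, h₀ ^ k = h) :
    Subgroup.closure ({h₀, h₀⁻¹} : Set H) = ⊤ := by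
  refine eq_top_iff.2 fun h _ => ?_
  obtain ⟨k, rfl⟩ := hH h
  exact zpow_mem (Subgroup.subset_closure (Set.mem_insert h₀ _)) k

variable {V : Type u} {Λ : SimpleGraph V}

theorem isVirtuallyCyclic_of_subsingleton {H : Type} [Group H] [IsCyclic H] [Subsingleton V] :
    IsVirtuallyCyclic (GraphProduct Λ (fun _ : V => H)) := by
  refine ⟨⊤, inferInstance, ?_⟩
  rcases isEmpty_or_nonempty V with hV | ⟨⟨x⟩⟩
  · have h : ∀ w : GraphProduct Λ (fun _ : V => H), w = 1 := fun w => by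
      have hw : w ∈ (⊤ : Subgroup (GraphProduct Λ (fun _ : V => H))) := trivial
      rw [← parabolic_univ] at hw
      by_contra hne
      exact hV.elim (exists_head_ne_one hw hne).choose
    have : Subsingleton (GraphProduct Λ (fun _ : V => H)) := ⟨fun v w => (h v).trans (h w).symm⟩
    infer_instance
  · have hr : (of Λ (fun _ => H) x).range = ⊤ := by
      rw [← closure_range_of]
      exact le_antisymm (le_iSup (fun x => (of Λ (fun _ => H) x).range) x)
        (iSup_le fun y => by rw [Subsingleton.elim y x])
    rw [← hr]
    exact isCyclic_of_surjective _ (of Λ (fun _ => H) x).rangeRestrict_surjective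

/-- The square could be shorter only if `h₀` or its cube were trivial, or the square itself. This
element of length 2 supplies aperiodicity for Artin groups, including those on two vertices. -/
theorem wordLength_sq {H : Type*} [Group H] {h₀ : H} (hH : ∀ h : H, ∃ k : ℤ, h₀ ^ k = h)
    (h : ∀ k : ℤ, h₀ ^ k = 1 → k = 0) : wordLength ({h₀, h₀⁻¹} : Set H) (h₀ ^ 2) = 2 := by
  have hcl := closure_pair_inv hH
  have hle : wordLength ({h₀, h₀⁻¹} : Set H) (h₀ ^ 2) ≤ 2 := by
    have := wordLength_le (S := ({h₀, h₀⁻¹} : Set H)) (w := [h₀, h₀]) (by simp)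
    simpa [pow_two] using this
  have hne : h₀ ^ 2 ≠ 1 := fun h2 => by
    have := h 2 (by exact_mod_cast h2)
    omega
  obtain ⟨s, t, hs, hst, -, hlen⟩ := exists_eq_mul_of_ne_one hcl hne
  refine le_antisymm hle ?_
  by_contra! hlt
  have ht : t = 1 := (wordLength_eq_zero hcl).1 (by omega)
  rw [ht, mul_one] at hst
  subst hst
  have key : h₀ ^ 2 = h₀ ∨ h₀ ^ 2 = h₀⁻¹ := by
    rcases hs with (hs | hs) | (hs | hs)
    · exact Or.inl hs
    · exact Or.inr hs
    · exact Or.inr (inv_eq_iff_eq_inv.1 hs)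
    · exact Or.inl (inv_injective hs)
  rcases key with hk | hk
  · have := h 1 (by
      rw [zpow_one]
      rw [pow_two] at hk
      exact mul_eq_left.1 hk)
    omega
  · have := h 3 (by
      have : h₀ ^ 3 = 1 := by rw [pow_succ, hk, inv_mul_cancel]
      exact_mod_cast this)
    omega

/-- Graph products of infinite cyclic groups. -/
theorem hasExactExponentialGrowth_of_int [Finite V] {H : Type} [Group H] [Infinite H]
    {h₀ : H} (hH : ∀ h : H, ∃ k : ℤ, h₀ ^ k = h) (h : ∀ k : ℤ, h₀ ^ k = 1 → k = 0)
    (hvc : ¬ IsVirtuallyCyclic (GraphProduct Λ (fun _ : V => H)))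
    (hprod : ¬ IsProductOfInfiniteGroups (GraphProduct Λ (fun _ : V => H))) :
    HasExactExponentialGrowth (standardGenerators Λ (fun _ : V => ({h₀, h₀⁻¹} : Set H))) := by
  have : IsCyclic H := ⟨h₀, fun h => hH h⟩
  have hS : ∀ _ : V, Subgroup.closure ({h₀, h₀⁻¹} : Set H) = ⊤ := fun _ => closure_pair_inv hH
  have hf : ∀ _ : V, ({h₀, h₀⁻¹} : Set H).Finite := fun _ => Set.toFinite _
  -- A proper nonempty `W` joined completely to its complement would split the group into two
  -- factors, each containing an infinite vertex group.
  have hanti : IsAnticonnected Λ Set.univ := by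
    intro W hW ⟨y, hy⟩
    by_contra! hcon
    obtain ⟨x, -, hx⟩ := Set.exists_of_ssubset hW
    exact hprod (isProductOfInfiniteGroups (A := W)
      (fun a ha b hb => (hcon b trivial hb a ha).symm)
      (infinite_parabolic_of_infinite hy) (infinite_parabolic_of_infinite (x := x) hx))
  rcases subsingleton_or_nontrivial V with hV | hV
  · exact absurd isVirtuallyCyclic_of_subsingleton hvc
  · obtain ⟨x, z, hxz⟩ := exists_pair_ne V
    obtain ⟨y, -, hyx, _, rfl, hxy⟩ := hanti {x} (by
      rw [Set.ssubset_univ_iff]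
      exact fun h => hxz.symm (by simpa using (h.symm ▸ Set.mem_univ z : z ∈ ({x} : Set V))))
      (Set.singleton_nonempty x)
    exact hasExactExponentialGrowth_of_tendsto hf hS
      (exists_tendsto_growthSeries hf hS hanti (Set.mem_univ _) (Set.mem_univ y) hyx
        (fun h => hxy h.symm) (Or.inl ⟨h₀ ^ 2, wordLength_sq hH h⟩))

end GraphProduct

/-! ### Cone vertices and right-angled Coxeter groups -/

namespace GraphProduct

variable {V : Type u} {Λ : SimpleGraph V} {G : V → Type v} [∀ x, Group (G x)]
  {S : ∀ x, Set (G x)}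

theorem exists_of_mul_of_mem_insert {W : Set V} {x : V} (hx : ∀ y ∈ W, Λ.Adj x y)
    {w : GraphProduct Λ G} (hw : w ∈ parabolic Λ G (insert x W)) :
    ∃ g, ∃ v ∈ parabolic Λ G W, w = of Λ G x g * v := by
  have step : ∀ z ∈ insert x W, ∀ (h : G z) (w : GraphProduct Λ G),
      (∃ g, ∃ v ∈ parabolic Λ G W, w = of Λ G x g * v) →
      ∃ g, ∃ v ∈ parabolic Λ G W, of Λ G z h * w = of Λ G x g * v := by
    rintro z hz h _ ⟨g, v, hv, rfl⟩
    rcases hz with rfl | hz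
    · exact ⟨h * g, v, hv, by rw [map_mul, mul_assoc]⟩
    · exact ⟨g, of Λ G z h * v, mul_mem (of_mem_parabolic hz h) hv, by
        rw [← mul_assoc, of_mul_of_comm (hx z hz).symm, mul_assoc]⟩
  refine parabolic_induction (P := fun w => ∃ g, ∃ v ∈ parabolic Λ G W, w = of Λ G x g * v)
    ⟨1, 1, one_mem _, by simp⟩ (fun z hz h _ w _ _ ih => step z hz h w ih) hw

/-- Adding a finite vertex group that commutes with all the others replaces the finite set `T` of
coset representatives of `⟨z⟩` by finitely many translates of it. -/
theorem isVirtuallyCyclic_of_cone {G : V → Type v} [∀ x, Group (G x)] [∀ x, Finite (G x)]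
    {U F : Set V} (hF : F.Finite) (hUF : ∀ x ∈ F, ∀ y, x ≠ y → Λ.Adj x y)
    {z : GraphProduct Λ G} {T : Set (GraphProduct Λ G)} (hT : T.Finite)
    (hU : ∀ w ∈ parabolic Λ G U, ∃ t ∈ T, ∃ k : ℤ, w = t * z ^ k) (hfull : U ∪ F = Set.univ) :
    IsVirtuallyCyclic (GraphProduct Λ G) := by
  have key : ∃ T' : Set (GraphProduct Λ G), T'.Finite ∧
      ∀ w ∈ parabolic Λ G (U ∪ F), ∃ t ∈ T', ∃ k : ℤ, w = t * z ^ k := by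
    clear hfull
    induction F, hF using Set.Finite.induction_on with
    | empty => exact ⟨T, hT, by simpa using hU⟩
    | @insert x F _ _ ih =>
      obtain ⟨T', hT', h⟩ := ih fun y hy => hUF y (Set.mem_insert_of_mem x hy)
      rw [Set.union_insert]
      by_cases hx : x ∈ U ∪ F
      · rw [Set.insert_eq_of_mem hx]
        exact ⟨T', hT', h⟩
      · refine ⟨Set.image2 (fun g t => of Λ G x g * t) Set.univ T',
          Set.finite_univ.image2 _ hT', fun w hw => ?_⟩
        obtain ⟨g, v, hv, rfl⟩ := exists_of_mul_of_mem_insert (fun y hy =>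
          hUF x (Set.mem_insert x F) y (by rintro rfl; exact hx hy)) hw
        obtain ⟨t, ht, k, rfl⟩ := h v hv
        exact ⟨_, ⟨g, trivial, t, ht, rfl⟩, k, (mul_assoc _ _ _).symm⟩
  obtain ⟨T', hT', h⟩ := key
  rw [hfull, parabolic_univ] at h
  have hfin : Finite (GraphProduct Λ G ⧸ Subgroup.zpowers z) := by
    have : Finite T' := hT'
    refine Finite.of_surjective (fun t : T' => (t.1 : GraphProduct Λ G ⧸ Subgroup.zpowers z))
      fun q => ?_
    obtain ⟨w, rfl⟩ := QuotientGroup.mk_surjective q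
    obtain ⟨t, ht, k, rfl⟩ := h w trivial
    refine ⟨⟨t, ht⟩, QuotientGroup.eq.2 ?_⟩
    rw [inv_mul_cancel_left]
    exact ⟨k, rfl⟩
  exact ⟨Subgroup.zpowers z, Subgroup.finiteIndex_of_finite_quotient, inferInstance⟩

/-- A group generated by two involutions `X`, `Y` is the union of two cosets of the cyclic group
generated by `X * Y`. -/
theorem exists_eq_mul_zpow_of_mem_pair {G : V → Type v} [∀ x, Group (G x)] {x y : V} {g : G x}
    {h : G y} (hg : ∀ a : G x, a ≠ 1 → a = g) (hh : ∀ a : G y, a ≠ 1 → a = h) (hg2 : g * g = 1)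
    (hh2 : h * h = 1) (w : GraphProduct Λ G) (hw : w ∈ parabolic Λ G {x, y}) :
    ∃ t ∈ ({1, of Λ G x g} : Set (GraphProduct Λ G)), ∃ k : ℤ,
      w = t * (of Λ G x g * of Λ G y h) ^ k := by
  set X := of Λ G x g with hX
  set Y := of Λ G y h with hY
  have hXX : X * X = 1 := by rw [hX, ← map_mul, hg2, map_one]
  have hYY : Y * Y = 1 := by rw [hY, ← map_mul, hh2, map_one]
  refine parabolic_induction (P := fun w => ∃ t ∈ ({1, X} : Set (GraphProduct Λ G)), ∃ k : ℤ,
    w = t * (X * Y) ^ k) ⟨1, by simp, 0, by simp⟩ (fun z hz a ha v _ _ ih => ?_) hw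
  obtain ⟨t, ht, k, rfl⟩ := ih
  have hz' : of Λ G z a = X ∨ of Λ G z a = Y := by
    rcases hz with rfl | hz
    · exact Or.inl (by rw [hg a ha])
    · rw [Set.mem_singleton_iff] at hz
      subst hz
      exact Or.inr (by rw [hh a ha])
  have hXY : X * (X * Y) = Y := by rw [← mul_assoc, hXX, one_mul]
  have hYX : Y * X = (X * Y)⁻¹ := by
    rw [mul_inv_rev, eq_comm, inv_eq_of_mul_eq_one_right hXX, inv_eq_of_mul_eq_one_right hYY]
  rcases hz' with hz' | hz' <;> rw [hz'] <;> rcases ht with rfl | ht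
  · exact ⟨X, by simp, k, by rw [one_mul]⟩
  · rw [Set.mem_singleton_iff.1 ht]
    exact ⟨1, by simp, k, by rw [← mul_assoc, hXX]⟩
  -- Here `Y = X (X Y)`; in the last case `Y X = (X Y)⁻¹` lowers the exponent instead.
  · refine ⟨X, by simp, 1 + k, ?_⟩
    rw [zpow_add, zpow_one, ← mul_assoc X, hXY, one_mul]
  · rw [Set.mem_singleton_iff.1 ht]
    refine ⟨1, by simp, -1 + k, ?_⟩
    rw [zpow_add, zpow_neg_one, ← hYX, one_mul, mul_assoc]

/-- Exact exponential growth of a parabolic subgroup persists when finite direct factors are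
added. -/
theorem exists_tendsto_union_of_cone [Finite V] {G : V → Type v} [∀ x, Group (G x)]
    [∀ x, Finite (G x)] {S : ∀ x, Set (G x)} (hf : ∀ x, (S x).Finite)
    (hS : ∀ x, Subgroup.closure (S x) = ⊤) {U F : Set V} (hF : F.Finite)
    (hUF : ∀ x ∈ F, ∀ y, x ≠ y → Λ.Adj x y) {τ : ℝ} (hτ : 0 < τ)
    (hU : ∃ c : ℝ, 0 < c ∧ Tendsto (fun n => ((PowerSeries.coeff n
      (growthSeries (len S) (parabolic Λ G U : Set (GraphProduct Λ G))) : ℕ) : ℝ) * τ ^ n)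
        atTop (𝓝 c)) :
    ∃ c : ℝ, 0 < c ∧ Tendsto (fun n => ((PowerSeries.coeff n
      (growthSeries (len S) (parabolic Λ G (U ∪ F) : Set (GraphProduct Λ G))) : ℕ) : ℝ) * τ ^ n)
        atTop (𝓝 c) := by
  have hfin := finite_len_eq (Λ := Λ) hf hS
  induction F, hF using Set.Finite.induction_on with
  | empty => simpa using hU
  | @insert x F _ _ ih =>
    obtain ⟨c, hc, hlim⟩ := ih fun y hy => hUF y (Set.mem_insert_of_mem x hy)
    rw [Set.union_insert]
    by_cases hx : x ∈ U ∪ F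
    · rw [Set.insert_eq_of_mem hx]
      exact ⟨c, hc, hlim⟩
    set W := U ∪ F with hW
    have hL : W ∩ {y | Λ.Adj x y} = W := Set.inter_eq_left.2 fun y hy =>
      hUF x (Set.mem_insert x F) y (by rintro rfl; exact hx hy)
    -- As `x` is adjacent to all of `W`, the renewal equation has no recursive term and reduces to a
    -- product with the series `a` of `G x`, a polynomial because `G x` is finite.
    have hB : nontrivialReps Λ G W W = ∅ := by
      rw [Set.eq_empty_iff_forall_notMem]
      rintro w ⟨⟨hw, hhead⟩, hne⟩
      obtain ⟨y, hy, h⟩ := exists_head_ne_one hw hne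
      exact h (hhead y hy)
    have hB0 : growthSeries (len S) (∅ : Set (GraphProduct Λ G)) = 0 := by
      ext n
      simp [coeff_growthSeries]
    have hren := growthSeries_parabolic_insert (Λ := Λ) hf hS hx
    rw [hL, hB, hB0, mul_zero, zero_mul, add_zero] at hren
    rw [hren]
    set a := 1 + growthSeries (len S) (syllables Λ G x) with ha
    have hafin : ∃ N, ∀ n, N < n → PowerSeries.coeff n a = 0 := by
      have h1 : (len S '' syllables Λ G x).Finite :=
        ((Set.toFinite {g : G x | g ≠ 1}).image _).image _
      obtain ⟨N, hN⟩ := h1.bddAbove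
      refine ⟨N, fun n hn => ?_⟩
      rw [ha, map_add, PowerSeries.coeff_one, if_neg (by omega), zero_add, coeff_growthSeries,
        Set.ncard_eq_zero ((hfin n).subset fun b hb => hb.2), Set.eq_empty_iff_forall_notMem]
      rintro w ⟨hw, rfl⟩
      exact absurd (hN ⟨w, hw, rfl⟩) (not_le.2 hn)
    obtain ⟨N, hN⟩ := hafin
    have hpos : ∀ n, 0 ≤ ((PowerSeries.coeff n a : ℕ) : ℝ) * τ ^ n := fun n => by positivity
    have hsum : Summable fun n => ((PowerSeries.coeff n a : ℕ) : ℝ) * τ ^ n :=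
      summable_of_ne_finset_zero (s := Finset.range (N + 1)) fun n hn => by
        rw [hN n (by simpa [Nat.lt_succ_iff] using hn), Nat.cast_zero, zero_mul]
    have hsum' : Summable fun n => |((PowerSeries.coeff n a : ℕ) : ℝ) * τ ^ n| := by
      simpa only [abs_of_nonneg (hpos _)] using hsum
    refine ⟨_, mul_pos ?_ hc, (tendsto_conv_atTop hsum' hlim).congr fun n => ?_⟩
    · refine hsum.tsum_pos hpos 0 ?_
      have : 0 < PowerSeries.coeff 0 a := by
        rw [ha, map_add, PowerSeries.coeff_zero_one]
        omega
      rw [pow_zero, mul_one]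
      exact_mod_cast this
    · rw [PowerSeries.coeff_mul, Finset.Nat.sum_antidiagonal_eq_sum_range_succ_mk]
      push_cast
      rw [Finset.sum_mul]
      refine Finset.sum_congr rfl fun k hk => ?_
      have : n = k + (n - k) := by
        have := Finset.mem_range.1 hk
        omega
      nth_rewrite 4 [this]
      rw [pow_add]
      ring

/-- Graph products of groups of order two. -/
theorem hasExactExponentialGrowth_of_two [Finite V] {H : Type} [Group H] [Nontrivial H]
    [Finite H] {h₀ : H} (hH : ∀ h : H, h ≠ 1 → h = h₀) (h2 : h₀ * h₀ = 1)
    (hvc : ¬ IsVirtuallyCyclic (GraphProduct Λ (fun _ : V => H)))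
    (hprod : ¬ IsProductOfInfiniteGroups (GraphProduct Λ (fun _ : V => H))) :
    HasExactExponentialGrowth (standardGenerators Λ (fun _ : V => ({h₀, h₀⁻¹} : Set H))) := by
  have hH' : ∀ h : H, ∃ k : ℤ, h₀ ^ k = h := fun h => by
    by_cases hh : h = 1
    · exact ⟨0, by rw [hh, zpow_zero]⟩
    · exact ⟨1, by rw [hH h hh, zpow_one]⟩
  have hS : ∀ _ : V, Subgroup.closure ({h₀, h₀⁻¹} : Set H) = ⊤ := fun _ => closure_pair_inv hH'
  have hf : ∀ _ : V, ({h₀, h₀⁻¹} : Set H).Finite := fun _ => Set.toFinite _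
  -- The cone vertices, which contribute a finite direct factor. A vertex outside `K` has a
  -- nonadjacent partner, which is also outside `K`.
  set K : Set V := {x | ∀ y, x ≠ y → Λ.Adj x y} with hK
  have hmem : ∀ x ∈ Kᶜ, ∃ y ∈ Kᶜ, x ≠ y ∧ ¬ Λ.Adj x y := fun x hx => by
    simp only [hK, Set.mem_compl_iff, Set.mem_ofPred_eq, not_forall, exists_prop] at hx
    obtain ⟨y, hxy, hadj⟩ := hx
    exact ⟨y, fun hy => hadj (hy x hxy.symm).symm, hxy, hadj⟩
  have hanti : IsAnticonnected Λ Kᶜ := by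
    intro W hW ⟨w, hw⟩
    by_contra! hcon
    obtain ⟨b, hbK, hbW⟩ := Set.exists_of_ssubset hW
    -- If `W` is joined to the rest of `Kᶜ`, nonadjacent partners lie on the same side of the
    -- partition. So each side contains a nonadjacent pair and hence generates an infinite subgroup.
    refine hprod (isProductOfInfiniteGroups (A := W ∪ K) (fun a ha c hc => ?_) ?_ ?_)
    · rcases ha with ha | ha
      · exact (hcon c (fun h => hc (Or.inr h)) (fun h => hc (Or.inl h)) a ha).symm
      · exact ha c (by rintro rfl; exact hc (Or.inr ha))
    · obtain ⟨y, hyK, hwy, hadj⟩ := hmem w (hW.subset hw)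
      have hyW : y ∈ W := by
        by_contra hyW
        exact hadj (hcon y hyK hyW w hw).symm
      exact infinite_parabolic_of_not_adj (Or.inl hw) (Or.inl hyW) hwy hadj
    · obtain ⟨y, hyK, hby, hadj⟩ := hmem b hbK
      have hyW : y ∉ W := fun hyW => hadj (hcon b hbK hbW y hyW)
      exact infinite_parabolic_of_not_adj (fun h => h.elim hbW hbK) (fun h => h.elim hyW hyK)
        hby hadj
  have hUK : Kᶜ ∪ K = Set.univ := Set.compl_union_self K
  by_cases h3 : 3 ≤ Kᶜ.ncard
  · obtain ⟨τ, hτ0, hτ1, hlim⟩ := exists_tendsto_of_three_le (Λ := Λ) hf hS hanti h3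
    have := exists_tendsto_union_of_cone hf hS (Set.toFinite K) (fun x hx => hx) hτ0 hlim
    rw [hUK] at this
    exact hasExactExponentialGrowth_of_tendsto hf hS ⟨τ, hτ0, hτ1, this⟩
  -- Vertices outside `K` come with a partner, so `Kᶜ` has 0 or 2 elements: the group is then finite
  -- or, up to the factor from `K`, generated by two involutions.
  · refine absurd ?_ hvc
    rcases Kᶜ.eq_empty_or_nonempty with hne | ⟨x, hx⟩
    · refine isVirtuallyCyclic_of_cone (U := Kᶜ) (z := 1) (T := {1}) (Set.toFinite K)
        (fun x hx => hx) (Set.finite_singleton 1) (fun w hw => ⟨1, rfl, 0, ?_⟩) hUK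
      rw [hne] at hw
      simpa [parabolic] using hw
    · obtain ⟨y, hy, hxy, -⟩ := hmem x hx
      have hpair : ({x, y} : Set V) = Kᶜ := by
        refine Set.eq_of_subset_of_ncard_le
          (Set.insert_subset hx (Set.singleton_subset_iff.2 hy)) ?_
        rw [Set.ncard_pair hxy]
        omega
      refine isVirtuallyCyclic_of_cone (U := Kᶜ) (Set.toFinite K) (fun x hx => hx)
        (Set.toFinite _) (fun w hw => ?_) hUK
        (T := {1, of Λ (fun _ => H) x h₀}) (z := of Λ (fun _ => H) x h₀ * of Λ (fun _ => H) y h₀)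
      rw [← hpair] at hw
      exact exists_eq_mul_zpow_of_mem_pair hH hH h2 h2 w hw

end GraphProduct

/-! ### The Artin and Coxeter presentations, and the theorem -/

theorem raagRelators_lift {V : Type u} {Λ : SimpleGraph V} {H : Type v} [Group H] (h₀ : H) :
    ∀ r ∈ raagRelators Λ,
      FreeGroup.lift (fun x => GraphProduct.of Λ (fun _ => H) x h₀) r = 1 := by
  rintro r ⟨x, y, hxy, rfl⟩
  simp only [map_mul, map_inv, FreeGroup.lift_apply_of]
  rw [GraphProduct.of_mul_of_comm hxy, mul_inv_cancel_right, mul_inv_cancel]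

theorem commute_of_raagRelators_subset {V : Type u} {Λ : SimpleGraph V} {rels : Set (FreeGroup V)}
    (h : raagRelators Λ ⊆ rels) {x y : V} (hxy : Λ.Adj x y) :
    Commute (PresentedGroup.of (rels := rels) x) (PresentedGroup.of (rels := rels) y) := by
  have h1 : PresentedGroup.mk rels (FreeGroup.of x * FreeGroup.of y * (FreeGroup.of x)⁻¹ *
      (FreeGroup.of y)⁻¹) = 1 := PresentedGroup.one_of_mem (h ⟨x, y, hxy, rfl⟩)
  simp only [map_mul, map_inv] at h1
  rw [mul_inv_eq_one, mul_inv_eq_iff_eq_mul] at h1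
  exact h1

theorem rightAngledArtinGroup_hasExactExponentialGrowth {V : Type u} [Finite V]
    (Λ : SimpleGraph V) (hvc : ¬ IsVirtuallyCyclic (RightAngledArtinGroup Λ))
    (hprod : ¬ IsProductOfInfiniteGroups (RightAngledArtinGroup Λ)) :
    HasExactExponentialGrowth (vertexGenerators (raagRelators Λ)) := by
  set h₀ : Multiplicative ℤ := Multiplicative.ofAdd 1 with hh₀
  have hpow : ∀ k : ℤ, h₀ ^ k = Multiplicative.ofAdd k := fun k => by
    rw [hh₀, ← ofAdd_zsmul, smul_eq_mul, mul_one]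
  have hH : ∀ h : Multiplicative ℤ, ∃ k : ℤ, h₀ ^ k = h := fun h =>
    ⟨Multiplicative.toAdd h, by rw [hpow, ofAdd_toAdd]⟩
  obtain ⟨e, he⟩ := GraphProduct.exists_mulEquiv_presentedGroup Λ hH
    (rels := raagRelators Λ) (fun x => zpowersHom _ (PresentedGroup.of x))
    (fun x => by simp [hh₀]) (raagRelators_lift h₀)
    (fun x y => commute_of_raagRelators_subset subset_rfl)
  rw [← GraphProduct.image_standardGenerators e he]
  refine (GraphProduct.hasExactExponentialGrowth_of_int hH (fun k hk => ?_)
    (fun h => hvc (h.of_mulEquiv e)) fun h => hprod (h.of_mulEquiv e)).image e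
  rw [hpow] at hk
  exact Multiplicative.ofAdd.injective hk

theorem rightAngledCoxeterGroup_hasExactExponentialGrowth {V : Type u} [Finite V]
    (Λ : SimpleGraph V) (hvc : ¬ IsVirtuallyCyclic (RightAngledCoxeterGroup Λ))
    (hprod : ¬ IsProductOfInfiniteGroups (RightAngledCoxeterGroup Λ)) :
    HasExactExponentialGrowth (vertexGenerators (racgRelators Λ)) := by
  set h₀ : Multiplicative (ZMod 2) := Multiplicative.ofAdd 1 with hh₀
  have hH : ∀ h : Multiplicative (ZMod 2), h ≠ 1 → h = h₀ := by decide
  have h2 : h₀ * h₀ = 1 := by decide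
  have h01 : h₀ ≠ 1 := by decide
  have hsq : ∀ x : V, PresentedGroup.of (rels := racgRelators Λ) x * PresentedGroup.of x = 1 :=
    fun x => by
      have h1 : PresentedGroup.mk (racgRelators Λ) (FreeGroup.of x ^ 2) = 1 :=
        PresentedGroup.one_of_mem (Or.inr ⟨x, rfl⟩)
      rwa [map_pow, pow_two] at h1
  let φ : V → Multiplicative (ZMod 2) →* PresentedGroup (racgRelators Λ) := fun x =>
    { toFun := fun h => if h = 1 then 1 else PresentedGroup.of x
      map_one' := if_pos rfl
      map_mul' := fun a b => by
        by_cases ha : a = 1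
        · simp [ha]
        · by_cases hb : b = 1
          · simp [hb]
          · rw [hH a ha, hH b hb, h2, if_pos rfl, if_neg h01, hsq] }
  obtain ⟨e, he⟩ := GraphProduct.exists_mulEquiv_presentedGroup Λ (h₀ := h₀)
    (fun h => by
      by_cases hh : h = 1
      · exact ⟨0, by rw [hh, zpow_zero]⟩
      · exact ⟨1, by rw [hH h hh, zpow_one]⟩)
    (rels := racgRelators Λ) φ (fun x => by simp [φ, h01]) (fun r hr => by
      rcases hr with hr | ⟨x, rfl⟩
      · exact raagRelators_lift h₀ r hr
      · rw [map_pow, FreeGroup.lift_apply_of, pow_two, ← map_mul, h2, map_one])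
    (fun x y => commute_of_raagRelators_subset Set.subset_union_left)
  rw [← GraphProduct.image_standardGenerators e he]
  exact (GraphProduct.hasExactExponentialGrowth_of_two hH h2
    (fun h => hvc (h.of_mulEquiv e)) fun h => hprod (h.of_mulEquiv e)).image e

theorem theorem10p2 {V : Type u} [Finite V] (Λ : SimpleGraph V) :
    -- graph products of nontrivial groups with geodesic combings
    (∀ (G : V → Type v) [∀ x, Group (G x)] [∀ x, Nontrivial (G x)] (S : ∀ x, Set (G x)),
      (∀ x, HasGeodesicCombing (S x)) → Λᶜ.Connected → 3 ≤ Nat.card V →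
        HasExactExponentialGrowth (GraphProduct.standardGenerators Λ S)) ∧
    -- right-angled Artin groups
    (¬ IsVirtuallyCyclic (RightAngledArtinGroup Λ) →
      ¬ IsProductOfInfiniteGroups (RightAngledArtinGroup Λ) →
        HasExactExponentialGrowth (vertexGenerators (raagRelators Λ))) ∧
    -- right-angled Coxeter groups
    (¬ IsVirtuallyCyclic (RightAngledCoxeterGroup Λ) →
      ¬ IsProductOfInfiniteGroups (RightAngledCoxeterGroup Λ) →
        HasExactExponentialGrowth (vertexGenerators (racgRelators Λ))) := by
  refine ⟨fun G _ _ S hS hΛ h3 => ?_, rightAngledArtinGroup_hasExactExponentialGrowth Λ,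
    rightAngledCoxeterGroup_hasExactExponentialGrowth Λ⟩
  exact GraphProduct.hasExactExponentialGrowth (fun x => (hS x).finite_and_closure.1)
    (fun x => (hS x).finite_and_closure.2) hΛ h3
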